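/- Let $V$ be a real vector space of finite dimension $n\ge 0$ and $W\subset V$ a linear subspace. For a finite-dimensional real vector space $F$ write $\Gamma(F)=C^\infty(V,F)$ for the $C^\infty(V)$-module of sections of the trivial bundle $F\times V\to V$, so $\mathfrak X(V)=\Gamma(V)$. The Koszul differential $d_j:\Gamma(\wedge^jV^*\otimes V)\to\Gamma(\wedge^{j-1}V^*\otimes V)$, $j\ge 2$, is contraction (in the first slot) with the Euler vector field $x\mapsto x$, and the anchor $\rho:\Gamma(V^*\otimes V)\to\mathfrak X(V)$ is $\rho(s)(x)=s(x)(x)$. The Nijenhuis–Richardson bracket of $s\in\Gamma(\wedge^{k}V^*\otimes V)$ and $t\in\Gamma(\wedge^{l}V^*\otimes V)$, $k,l\ge1$, is $$[s,t]=i_st-(-1)^{(k-1)(l-1)}i_ts+\delta_{k,1}\,\rho(s)(t)-\delta_{l,1}\,\rho(t)(s)\in\Gamma(\wedge^{k+l-1}V^*\otimes V),$$ where $i$ is the pointwise bilinear operation with $i_{\phi_1\otimes w_1}(\phi_2\otimes w_2)=\phi_1\wedge\iota_{w_1}\phi_2\otimes w_2$, i.e. $(i_\phi\psi)(v_1,\dots,v_{k+l-1})=\sum_\sigma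 \mathrm{sgn}(\sigma)\,\psi(\phi(v_{\sigma(1)},\dots,v_{\sigma(k)}),v_{\sigma(k+1)},\dots,v_{\sigma(k+l-1)})$ (sum over $(k,l-1)$-shuffles), and $X(t)$ denotes the derivative of the vector-valued function $t$ along the vector field $X$. For $j\ge 1$ let $K_j\subset\wedge^jV^*\otimes V=\mathrm{Hom}(\wedge^jV,V)$ be the subspace of all $\phi$ with $\phi(w,v_1,\dots,v_{j-1})\in W$ for all $w\in W$, $v_i\in V$; so $K_j=0$ for $j>n$. Let $\mathcal F_W=\{X\in\mathfrak X(V): X(0)=0,\ X(I_W)\subset I_W\}$, where $I_W\subset C^\infty(V)$ is the ideal of functions vanishing on $W$; it is a finitely generated $C^\infty(V)$-submodule of $\mathfrak X(V)$ closed under the Lie bracket. Then: (i) $d_j(\Gamma(K_j))\subset\Gamma(K_{j-1})$ for $j\ge2$. (ii) $[\Gamma(K_k),\Gamma(K_l)]\subset\Gamma(K_{k+l-1})$ for $k,l\ge1$. (iii) $\rho$ maps $\Gamma(K_1)$ into $\mathcal F_W$, and the complex $$0\to\Gamma(K_n)\xrightarrow{d_n}\Gamma(K_{n-1})\to\cdots\xrightarrow{d_2}\Gamma(K_1)\xrightarrow{\rho}\mathcal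 F_W\to0$$ is exact. Consequently $\Gamma(K_\bullet)$, with $K_j$ in degree $1-j$, anchor $\rho$, unary bracket $d_\bullet$ (zero on $\Gamma(K_1)$), binary bracket $[-,-]$ and all other brackets zero, is a universal $L_\infty$-algebroid of $\mathcal F_W$ which is minimal at the origin. Here an $L_\infty$-algebroid over $V$ is a non-positively graded vector bundle $E$ whose space of sections carries graded skew-symmetric brackets $\ell_k$ of degree $2-k$ ($k\ge1$) satisfying the higher Jacobi identities, with a vector bundle map $\rho:E_0\to TV$, such that $\ell_k$ is $C^\infty(V)$-multilinear for $k\ne2$, $\ell_2$ satisfies the Leibniz rule with respect to $\rho$ (extended by zero to nonzero degrees), $\rho$ intertwines $\ell_2$ with the Lie bracket, and $\rho\circ\ell_1=0$; it is a universal $L_\infty$-algebroid of $\mathcal F$ if $\cdots\xrightarrow{\ell_1}\Gamma(E_{-1})\xrightarrow{\ell_1}\Gamma(E_0)\xrightarrow{\rho}\mathcal F\to0$ is exact (it is built on a resolution of $\mathcal F$ by sections of vector bundles), and minimal at the origin if all the differentials $\ell_1$, as vector bundle maps, vanish at the origin. -/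

import Mathlib

open scoped ContDiff Manifold DirectSum

noncomputable section

namespace SubspaceFoliation

section Sections

variable (V : Type*) [NormedAddCommGroup V] [NormedSpace ℝ V]

/-- Smooth sections `Γ(F)` of the trivial vector bundle `F × V → V`, i.e. smooth maps `V → F`. -/
def Sec (F : Type*) [NormedAddCommGroup F] [NormedSpace ℝ F] : Type _ :=
  C^∞⟮𝓘(ℝ, V), V; 𝓘(ℝ, F), F⟯

/-- The ring `C^∞(V)`. -/
abbrev SmoothFun : Type _ := Sec V ℝ

/-- The `C^∞(V)`-module `𝔛(V)` of vector fields on `V`. -/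
abbrev VecField : Type _ := Sec V V

variable {V}
variable {F : Type*} [NormedAddCommGroup F] [NormedSpace ℝ F]
variable {G : Type*} [NormedAddCommGroup G] [NormedSpace ℝ G]

/-! The pointwise algebraic structures, all of them those of Mathlib. -/

instance : FunLike (Sec V F) V F := inferInstanceAs (FunLike C^∞⟮𝓘(ℝ, V), V; 𝓘(ℝ, F), F⟯ V F)

instance : AddCommGroup (Sec V F) := inferInstanceAs (AddCommGroup C^∞⟮𝓘(ℝ, V), V; 𝓘(ℝ, F), F⟯)

instance : CommRing (SmoothFun V) := inferInstanceAs (CommRing C^∞⟮𝓘(ℝ, V), V; 𝓘(ℝ, ℝ), ℝ⟯)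

instance : Module ℝ (Sec V F) := inferInstanceAs (Module ℝ C^∞⟮𝓘(ℝ, V), V; 𝓘(ℝ, F), F⟯)

instance : Module (SmoothFun V) (Sec V F) :=
  inferInstanceAs (Module C^∞⟮𝓘(ℝ, V), V; 𝓘(ℝ, ℝ), ℝ⟯ C^∞⟮𝓘(ℝ, V), V; 𝓘(ℝ, F), F⟯)

@[ext] theorem Sec.ext {s t : Sec V F} (h : ∀ x, s x = t x) : s = t := DFunLike.ext _ _ h

@[simp] theorem Sec.zero_apply (x : V) : (0 : Sec V F) x = 0 := rfl

@[simp] theorem Sec.add_apply (s t : Sec V F) (x : V) : (s + t) x = s x + t x := rfl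

@[simp] theorem Sec.neg_apply (s : Sec V F) (x : V) : (-s) x = -s x := rfl

@[simp] theorem Sec.sub_apply (s t : Sec V F) (x : V) : (s - t) x = s x - t x := rfl

@[simp] theorem Sec.smul_apply (c : ℝ) (s : Sec V F) (x : V) : (c • s) x = c • s x := rfl

@[simp] theorem Sec.fun_smul_apply (f : SmoothFun V) (s : Sec V F) (x : V) :
    (f • s) x = f x • s x := rfl

@[simp] theorem Sec.mul_apply (f g : SmoothFun V) (x : V) : (f * g) x = f x * g x := rfl

@[simp] theorem Sec.one_apply (x : V) : (1 : SmoothFun V) x = 1 := rfl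

/-- Bundle a smooth map as a section. -/
def mkSec (f : V → F) (hf : ContDiff ℝ ∞ f) : Sec V F :=
  (⟨f, hf.contMDiff⟩ : C^∞⟮𝓘(ℝ, V), V; 𝓘(ℝ, F), F⟯)

@[simp] theorem mkSec_apply (f : V → F) (hf : ContDiff ℝ ∞ f) (x : V) : mkSec f hf x = f x := rfl

theorem Sec.contDiff (s : Sec V F) : ContDiff ℝ ∞ (s : V → F) :=
  (ContMDiffMap.contMDiff (I := 𝓘(ℝ, V)) (I' := 𝓘(ℝ, F)) s).contDiff

/-- The derivative `X(s)` of a section `s` of a trivial bundle along the vector field `X`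
(for `F = ℝ`: the action of `X` on functions). -/
def dirDeriv (X : VecField V) (s : Sec V F) : Sec V F :=
  mkSec (fun x => fderiv ℝ s x (X x))
    ((s.contDiff.fderiv_right (m := ∞) (by simp)).clm_apply X.contDiff)

/-- The Lie bracket of vector fields. -/
def lieBr (X Y : VecField V) : VecField V :=
  mkSec (VectorField.lieBracket ℝ X Y)
    (X.contDiff.lieBracket_vectorField (m := ∞) Y.contDiff (by simp))

/-- Post-composition of sections with a constant linear bundle map. -/
def mapSec (A : F →L[ℝ] G) : Sec V F →ₗ[SmoothFun V] Sec V G where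
  toFun s := mkSec (fun x => A (s x)) (A.contDiff.comp s.contDiff)
  map_add' s t := by ext x; exact A.map_add (s x) (t x)
  map_smul' f s := by ext x; exact A.map_smul (f x) (s x)

end Sections

/-! ### `L_∞`-algebroids over a vector space -/

section LInfinity

/-- For `x_p` homogeneous of degree `-d p`, the sign `sgn(σ) ε(σ; x)` with
`x_{σ 0} ∧ … ∧ x_{σ (k-1)} = sgn(σ) ε(σ; x) x_0 ∧ … ∧ x_{k-1}`: every inverted pair contributes
`-(-1)^{|x_p| |x_q|}`. -/
def skewSign {k : ℕ} (d : Fin k → ℕ) (σ : Equiv.Perm (Fin k)) : ℝ :=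
  ∏ p : Fin k, ∏ q : Fin k, if p < q ∧ σ q < σ p then -(-1) ^ (d (σ p) * d (σ q)) else 1

/-- The same sign for the unshuffle that moves the entries with index in `S`, in increasing order,
in front of the entries with index in `Sᶜ`, in increasing order. -/
def unshuffleSign {k : ℕ} (d : Fin k → ℕ) (S : Finset (Fin k)) : ℝ :=
  ∏ p ∈ S, ∏ q ∈ Sᶜ, if q < p then -(-1) ^ (d p * d q) else 1

variable (V : Type*) [NormedAddCommGroup V] [NormedSpace ℝ V]
variable (F : ℕ → Type*) [∀ i, NormedAddCommGroup (F i)] [∀ i, NormedSpace ℝ (F i)]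

/-- Sections of the graded vector bundle `⨁ i, F i × V`, with `F i × V` placed in degree `-i`. -/
abbrev GrSec : Type _ := ⨁ i, Sec V (F i)

variable {V F}

/-- A section of the component of degree `-i`, as a section of the graded bundle. -/
abbrev homog (i : ℕ) (s : Sec V (F i)) : GrSec V F := DirectSum.of (fun i => Sec V (F i)) i s

/-- A tuple of homogeneous sections. -/
abbrev homogTuple {k : ℕ} (d : Fin k → ℕ) (x : ∀ p, Sec V (F (d p))) : Fin k → GrSec V F :=
  fun p => homog (d p) (x p)

variable (V F)

/-- An `L_∞`-algebroid over `V` whose underlying graded vector bundle has fibre `F i` in degree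
`-i` (vector bundles over `V` are trivial, being bundles over a contractible space). The brackets
`bracket k = ℓ_k` have degree `2 - k`. -/
structure LInftyAlgebroid [FiniteDimensional ℝ V] [∀ i, FiniteDimensional ℝ (F i)] where
  /-- The multibrackets. -/
  bracket : ∀ k : ℕ, MultilinearMap ℝ (fun _ : Fin k => GrSec V F) (GrSec V F)
  /-- The anchor, a vector bundle map from the component of degree `0` to the tangent bundle. -/
  anchor : Sec V (F 0) →ₗ[SmoothFun V] VecField V
  /-- `ℓ_k` has degree `2 - k`. -/
  degree : ∀ (k : ℕ) (d : Fin k → ℕ) (x : ∀ p, Sec V (F (d p))) (m : ℕ),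
    -(m : ℤ) ≠ (∑ p, -(d p : ℤ)) + (2 - k) → bracket k (homogTuple d x) m = 0
  /-- `ℓ_k` is graded skew-symmetric. -/
  skew : ∀ (k : ℕ) (d : Fin k → ℕ) (x : ∀ p, Sec V (F (d p))) (σ : Equiv.Perm (Fin k)),
    bracket k (homogTuple d x ∘ σ) = skewSign d σ • bracket k (homogTuple d x)
  /-- The higher Jacobi identities: for all `n ≥ 1`,
  `∑_{i + j = n + 1} (-1)^{i (j - 1)} ∑_{(i, n - i)-unshuffles σ}
    sgn(σ) ε(σ; x) ℓ_j (ℓ_i (x_{σ 1}, …, x_{σ i}), x_{σ (i + 1)}, …, x_{σ n}) = 0`.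
  An `(i, n - i)`-unshuffle is determined by the set `S` of its first `i ≥ 1` values. -/
  jacobi : ∀ (n : ℕ) (d : Fin n → ℕ) (x : ∀ p, Sec V (F (d p))),
    ∑ S ∈ (Finset.univ : Finset (Finset (Fin n))) with S.Nonempty,
      ((-1) ^ (S.card * Sᶜ.card) * unshuffleSign d S) •
        bracket (Sᶜ.card + 1)
          (Fin.cons (bracket S.card (homogTuple d x ∘ S.orderEmbOfFin rfl))
            (homogTuple d x ∘ Sᶜ.orderEmbOfFin rfl)) = 0
  /-- `ℓ_k` is `C^∞(V)`-multilinear for `k ≠ 2`. -/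
  bracket_smul : ∀ (k : ℕ), k ≠ 2 → ∀ (x : Fin k → GrSec V F) (p : Fin k) (f : SmoothFun V),
    bracket k (Function.update x p (f • x p)) = f • bracket k x
  /-- The Leibniz rule for `ℓ_2`; only the degree `0` component of a section is acted upon by the
  anchor. -/
  leibniz : ∀ (x y : GrSec V F) (f : SmoothFun V),
    bracket 2 ![x, f • y] = f • bracket 2 ![x, y] + dirDeriv (anchor (x 0)) f • y
  /-- The anchor intertwines `ℓ_2` and the Lie bracket of vector fields. -/
  anchor_bracket : ∀ s t : Sec V (F 0),
    anchor (bracket 2 ![homog 0 s, homog 0 t] 0) = lieBr (anchor s) (anchor t)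
  /-- The anchor vanishes on the image of `ℓ_1`. -/
  anchor_diff : ∀ s : Sec V (F 1), anchor (bracket 1 ![homog 1 s] 0) = 0

variable {V F}
variable [FiniteDimensional ℝ V] [∀ i, FiniteDimensional ℝ (F i)]

namespace LInftyAlgebroid

/-- The unary bracket `Γ(F (i + 1)) → Γ(F i)`. -/
def diff (L : LInftyAlgebroid V F) (i : ℕ) (s : Sec V (F (i + 1))) : Sec V (F i) :=
  L.bracket 1 ![homog (i + 1) s] i

/-- A dg-Lie algebroid: only the unary and the binary bracket may be nonzero. -/
def IsDGLie (L : LInftyAlgebroid V F) : Prop := ∀ k, 3 ≤ k → L.bracket k = 0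

/-- `L` is a universal `L_∞`-algebroid of the foliation `𝓕`: it is built on a resolution
`… → Γ(F 1) → Γ(F 0) → 𝓕 → 0` of `𝓕` by sections of vector bundles, that is, this sequence, given
by the unary bracket and the anchor, is exact. -/
structure IsUniversal (L : LInftyAlgebroid V F) (𝓕 : Submodule (SmoothFun V) (VecField V)) :
    Prop where
  range_anchor : LinearMap.range L.anchor = 𝓕
  exact_zero : ∀ s : Sec V (F 0), L.anchor s = 0 ↔ ∃ t, L.diff 0 t = s
  exact_succ : ∀ (i : ℕ) (s : Sec V (F (i + 1))), L.diff i s = 0 ↔ ∃ t, L.diff (i + 1) t = s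

/-- `L` is minimal at the point `q`: the differentials, as vector bundle maps, vanish at `q`. -/
def IsMinimalAt (L : LInftyAlgebroid V F) (q : V) : Prop :=
  ∀ (i : ℕ) (s : Sec V (F (i + 1))), L.diff i s q = 0

end LInftyAlgebroid

end LInfinity

/-! ### The Koszul differential and the Nijenhuis–Richardson bracket -/

section Koszul

variable (V : Type*) [NormedAddCommGroup V] [NormedSpace ℝ V]

/-- `∧^j V^* ⊗ V = Hom(∧^j V, V)`, as alternating maps (continuity is automatic when `V` is finite
dimensional). -/
abbrev Alt (j : ℕ) : Type _ := V [⋀^Fin j]→L[ℝ] V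

/-- The fibre `∧^{j+1} V^* ⊗ V`, placed in degree `-j`. -/
abbrev AltFib (j : ℕ) : Type _ := Alt V (j + 1)

instance instFiniteDimensionalAlt [FiniteDimensional ℝ V] (j : ℕ) :
    FiniteDimensional ℝ (Alt V j) :=
  Module.Finite.of_injective
    ((AlternatingMap.toMultilinearMapLM (S := ℝ)).comp
      (ContinuousAlternatingMap.toAlternatingMapLinear (R := ℝ) :
        Alt V j →ₗ[ℝ] V [⋀^Fin j]→ₗ[ℝ] V))
    (fun f g h => by
      ext v
      exact congrArg (fun m : MultilinearMap ℝ (fun _ : Fin j => V) V => m v) h)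

variable {V}

theorem contDiff_contract {j : ℕ} (s : Sec V (Alt V (j + 1))) :
    ContDiff ℝ ∞ (fun x : V => (s x).curryLeft x) := by
  let A : Alt V (j + 1) →L[ℝ] V →L[ℝ] Alt V j :=
    (ContinuousAlternatingMap.curryLeftLI (𝕜 := ℝ) (E := V) (F := V) (n := j)).toContinuousLinearMap
  have hA : ContDiff ℝ ∞ A := by fun_prop
  exact ContDiff.clm_apply (f := fun x => A (s x)) (hA.comp s.contDiff) contDiff_id

theorem contDiff_anchor (s : Sec V (Alt V 1)) : ContDiff ℝ ∞ (fun x : V => s x (fun _ => x)) := by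
  have h := (ContinuousAlternatingMap.apply ℝ V V (ι := Fin 0)
    (fun i => i.elim0)).contDiff.comp (contDiff_contract s)
  convert h using 2 with x
  change s x (fun _ => x) = s x (Fin.cons x _)
  congr 1
  ext i
  rw [Subsingleton.elim i 0]
  rfl

/-- The Koszul differential `Γ(∧^{j+1} V^* ⊗ V) → Γ(∧^j V^* ⊗ V)`: contraction (in the first slot)
with the Euler vector field, whose value at `x` is `x`. -/
def koszul (j : ℕ) : Sec V (Alt V (j + 1)) →ₗ[SmoothFun V] Sec V (Alt V j) where
  toFun s := mkSec (fun x => (s x).curryLeft x) (contDiff_contract s)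
  map_add' s t := by ext x v; rfl
  map_smul' f s := by ext x v; rfl

@[simp] theorem koszul_apply (j : ℕ) (s : Sec V (Alt V (j + 1))) (x : V) (v : Fin j → V) :
    koszul j s x v = s x (Fin.cons x v) := rfl

/-- The anchor `ρ : Γ(V^* ⊗ V) → 𝔛(V)`: contraction with the Euler vector field. -/
def anchorMap : Sec V (Alt V 1) →ₗ[SmoothFun V] VecField V where
  toFun s := mkSec (fun x => s x (fun _ => x)) (contDiff_anchor s)
  map_add' s t := by ext x; rfl
  map_smul' f s := by ext x; rfl

/-- The anchor, extended by zero to the components of nonzero degree. -/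
def anchorDeg : ∀ a : ℕ, Sec V (Alt V (a + 1)) → VecField V
  | 0, s => anchorMap s
  | _ + 1, _ => 0

/-- The first `a + 1` of `a + b + 1` positions. -/
def firstPos (a b : ℕ) (i : Fin (a + 1)) : Fin (a + b + 1) := ⟨i, by omega⟩

/-- The last `b` of `a + b + 1` positions. -/
def lastPos (a b : ℕ) (i : Fin b) : Fin (a + b + 1) := ⟨a + 1 + i, by omega⟩

theorem firstPos_injective (a b : ℕ) : Function.Injective (firstPos a b) := by
  intro i j h
  simpa [firstPos, Fin.ext_iff] using h

theorem lastPos_injective (a b : ℕ) : Function.Injective (lastPos a b) := by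
  intro i j h
  simpa [lastPos, Fin.ext_iff] using h

theorem firstPos_ne_lastPos {a b : ℕ} (i : Fin (a + 1)) (j : Fin b) :
    firstPos a b i ≠ lastPos a b j := by
  intro h
  have := i.2
  simp only [firstPos, lastPos, Fin.ext_iff] at h
  omega

theorem exists_pos {a b : ℕ} (p : Fin (a + b + 1)) :
    (∃ i, p = firstPos a b i) ∨ ∃ i, p = lastPos a b i := by
  by_cases h : (p : ℕ) < a + 1
  · exact Or.inl ⟨⟨p, h⟩, rfl⟩
  · refine Or.inr ⟨⟨p - (a + 1), by omega⟩, ?_⟩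
    simp only [lastPos, Fin.ext_iff]
    omega

/-- The multilinear map `v ↦ ψ (φ (v_0, …, v_a), v_{a+1}, …, v_{a+b})`. -/
def insertMulti (a b : ℕ) (φ : Alt V (a + 1)) (ψ : Alt V (b + 1)) :
    ContinuousMultilinearMap ℝ (fun _ : Fin (a + b + 1) => V) V where
  toFun v := ψ (Fin.cons (φ (v ∘ firstPos a b)) (v ∘ lastPos a b))
  map_update_add' := by
    intro inst v p x y
    obtain rfl : inst = instDecidableEqFin _ := Subsingleton.elim _ _
    change ψ.curryLeft _ _ = ψ.curryLeft _ _ + ψ.curryLeft _ _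
    rcases exists_pos p with ⟨i, rfl⟩ | ⟨i, rfl⟩
    · have h : ∀ z, Function.update v (firstPos a b i) z ∘ lastPos a b = v ∘ lastPos a b :=
        fun z => Function.update_comp_eq_of_forall_ne _ _ fun j => (firstPos_ne_lastPos i j).symm
      simp only [h, Function.update_comp_eq_of_injective _ (firstPos_injective a b),
        ContinuousAlternatingMap.map_update_add, map_add, ContinuousAlternatingMap.add_apply]
    · have h : ∀ z, Function.update v (lastPos a b i) z ∘ firstPos a b = v ∘ firstPos a b :=
        fun z => Function.update_comp_eq_of_forall_ne _ _ fun j => firstPos_ne_lastPos j i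
      simp only [h, Function.update_comp_eq_of_injective _ (lastPos_injective a b),
        ContinuousAlternatingMap.map_update_add]
  map_update_smul' := by
    intro inst v p c x
    obtain rfl : inst = instDecidableEqFin _ := Subsingleton.elim _ _
    change ψ.curryLeft _ _ = c • ψ.curryLeft _ _
    rcases exists_pos p with ⟨i, rfl⟩ | ⟨i, rfl⟩
    · have h : ∀ z, Function.update v (firstPos a b i) z ∘ lastPos a b = v ∘ lastPos a b :=
        fun z => Function.update_comp_eq_of_forall_ne _ _ fun j => (firstPos_ne_lastPos i j).symm
      simp only [h, Function.update_comp_eq_of_injective _ (firstPos_injective a b),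
        ContinuousAlternatingMap.map_update_smul, map_smul, ContinuousAlternatingMap.smul_apply]
    · have h : ∀ z, Function.update v (lastPos a b i) z ∘ firstPos a b = v ∘ firstPos a b :=
        fun z => Function.update_comp_eq_of_forall_ne _ _ fun j => firstPos_ne_lastPos j i
      simp only [h, Function.update_comp_eq_of_injective _ (lastPos_injective a b),
        ContinuousAlternatingMap.map_update_smul]
  cont := by
    refine ψ.cont.comp (continuous_pi fun i => ?_)
    refine Fin.cases ?_ (fun j => ?_) i
    · exact φ.cont.comp (continuous_pi fun j => continuous_apply _)
    · exact continuous_apply _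

/-- The insertion `i_φ ψ`, equal to `φ₁ ∧ ι_{w₁} φ₂ ⊗ w₂` for `φ = φ₁ ⊗ w₁` and `ψ = φ₂ ⊗ w₂`:
`(i_φ ψ)(v) = ∑_{(a + 1, b)-shuffles σ} sgn(σ) ψ (φ (v_{σ 0}, …, v_{σ a}), v_{σ (a+1)}, …)`.
The sum over shuffles is written as the sum over all permutations divided by `(a + 1)! b!`. -/
def insertion (a b : ℕ) (φ : Alt V (a + 1)) (ψ : Alt V (b + 1)) : Alt V (a + b + 1) :=
  (((a + 1).factorial * b.factorial : ℕ) : ℝ)⁻¹ •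
    ContinuousMultilinearMap.alternatization (insertMulti a b φ ψ)

theorem insertion_apply (a b : ℕ) (φ : Alt V (a + 1)) (ψ : Alt V (b + 1))
    (v : Fin (a + b + 1) → V) :
    insertion a b φ ψ v = (((a + 1).factorial * b.factorial : ℕ) : ℝ)⁻¹ •
      ∑ σ : Equiv.Perm (Fin (a + b + 1)), Equiv.Perm.sign σ •
        ψ (Fin.cons (φ (v ∘ σ ∘ firstPos a b)) (v ∘ σ ∘ lastPos a b)) := by
  simp only [insertion, ContinuousAlternatingMap.smul_apply,
    ContinuousMultilinearMap.alternatization_apply_apply]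
  rfl

/-- The insertion as a bilinear map. -/
def insertionBilin (a b : ℕ) : Alt V (a + 1) →ₗ[ℝ] Alt V (b + 1) →ₗ[ℝ] Alt V (a + b + 1) :=
  LinearMap.mk₂ ℝ (insertion a b)
    (fun φ φ' ψ => by
      ext v
      rw [ContinuousAlternatingMap.add_apply, insertion_apply, insertion_apply, insertion_apply,
        ← smul_add, ← Finset.sum_add_distrib]
      refine congrArg _ (Finset.sum_congr rfl fun σ _ => ?_)
      rw [← smul_add]
      refine congrArg _ ?_
      change ψ.curryLeft _ _ = ψ.curryLeft _ _ + ψ.curryLeft _ _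
      rw [ContinuousAlternatingMap.add_apply, map_add]; rfl)
    (fun c φ ψ => by
      ext v
      rw [ContinuousAlternatingMap.smul_apply, insertion_apply, insertion_apply, smul_comm c]
      refine congrArg _ ?_
      rw [Finset.smul_sum]
      refine Finset.sum_congr rfl fun σ _ => ?_
      rw [smul_comm c]
      refine congrArg _ ?_
      change ψ.curryLeft (c • _) _ = c • ψ.curryLeft _ _
      rw [map_smul]; rfl)
    (fun φ ψ ψ' => by
      ext v
      simp only [insertion_apply, ContinuousAlternatingMap.add_apply, smul_add,
        Finset.sum_add_distrib])
    (fun c φ ψ => by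
      ext v
      rw [ContinuousAlternatingMap.smul_apply, insertion_apply, insertion_apply, smul_comm c]
      refine congrArg _ ?_
      rw [Finset.smul_sum]
      refine Finset.sum_congr rfl fun σ _ => ?_
      rw [smul_comm c]
      rfl)

variable [FiniteDimensional ℝ V]

theorem contDiff_insertion (a b : ℕ) (s : Sec V (Alt V (a + 1))) (t : Sec V (Alt V (b + 1))) :
    ContDiff ℝ ∞ (fun x : V => insertion a b (s x) (t x)) := by
  let A : Alt V (a + 1) →L[ℝ] Alt V (b + 1) →L[ℝ] Alt V (a + b + 1) :=
    (insertionBilin a b).toContinuousBilinearMap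
  have hA : ContDiff ℝ ∞ A := by fun_prop
  exact ContDiff.clm_apply (f := fun x => A (s x)) (hA.comp s.contDiff) t.contDiff

/-- The pointwise insertion of sections. -/
def insertSec (a b : ℕ) (s : Sec V (Alt V (a + 1))) (t : Sec V (Alt V (b + 1))) :
    Sec V (Alt V (a + b + 1)) :=
  mkSec (fun x => insertion a b (s x) (t x)) (contDiff_insertion a b s t)

/-- The Nijenhuis–Richardson bracket of `s ∈ Γ(∧^{a+1} V^* ⊗ V)` (degree `-a`) and
`t ∈ Γ(∧^{b+1} V^* ⊗ V)` (degree `-b`), extended to nonconstant sections through the anchor: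
`i_s t - (-1)^{ab} i_t s + ρ(s)(t) - ρ(t)(s)`, where `ρ(s) = 0` unless `a = 0` and `ρ(t) = 0`
unless `b = 0`. Its values lie in the component `Γ(∧^{a+b+1} V^* ⊗ V)` of degree `-(a + b)`. -/
def nrBracket {a b : ℕ} (s : Sec V (Alt V (a + 1))) (t : Sec V (Alt V (b + 1))) :
    GrSec V (AltFib V) :=
  homog (F := AltFib V) (a + b) (insertSec a b s t)
    - (-1 : ℝ) ^ (a * b) • homog (F := AltFib V) (b + a) (insertSec b a t s)
    + homog (F := AltFib V) b (dirDeriv (anchorDeg a s) t)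
    - homog (F := AltFib V) a (dirDeriv (anchorDeg b t) s)

end Koszul

/-! ### The foliation and the subbundles attached to a subspace -/

section Subspace

variable {V : Type*} [NormedAddCommGroup V] [NormedSpace ℝ V] (W : Submodule ℝ V)

/-- `𝓕_W`: the vector fields `X` with `X(0) = 0` and `X(I_W) ⊆ I_W`, where `I_W ⊆ C^∞(V)` is the
ideal of functions vanishing on `W`. -/
def foliation : Submodule (SmoothFun V) (VecField V) where
  carrier := {X | X 0 = 0 ∧
    ∀ f : SmoothFun V, (∀ w ∈ W, f w = 0) → ∀ w ∈ W, dirDeriv X f w = 0}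
  zero_mem' := ⟨rfl, fun f _ w _ => (fderiv ℝ f w).map_zero⟩
  add_mem' := by
    rintro X Y ⟨hX, hX'⟩ ⟨hY, hY'⟩
    refine ⟨?_, fun f hf w hw => ?_⟩
    · change X 0 + Y 0 = 0
      rw [hX, hY, add_zero]
    · change fderiv ℝ f w (X w + Y w) = 0
      have h1 : fderiv ℝ f w (X w) = 0 := hX' f hf w hw
      have h2 : fderiv ℝ f w (Y w) = 0 := hY' f hf w hw
      rw [map_add, h1, h2, add_zero]
  smul_mem' := by
    rintro g X ⟨hX, hX'⟩
    refine ⟨?_, fun f hf w hw => ?_⟩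
    · change g 0 • X 0 = 0
      rw [hX, smul_zero]
    · change fderiv ℝ f w (g w • X w) = 0
      have h1 : fderiv ℝ f w (X w) = 0 := hX' f hf w hw
      rw [map_smul, h1, smul_zero]

/-- `K_{j+1} ⊆ ∧^{j+1} V^* ⊗ V`: the forms `φ` with `φ(w, v_1, …, v_j) ∈ W` for all `w ∈ W`. -/
def K (j : ℕ) : Submodule ℝ (Alt V (j + 1)) where
  carrier := {φ | ∀ w ∈ W, ∀ v : Fin j → V, φ (Fin.cons w v) ∈ W}
  zero_mem' := fun _ _ _ => W.zero_mem
  add_mem' := fun hφ hψ w hw v => W.add_mem (hφ w hw v) (hψ w hw v)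
  smul_mem' := fun c _ hφ w hw v => W.smul_mem c (hφ w hw v)

/-- `K_{j+1}` as a fibre, placed in degree `-j`. -/
def KFib (j : ℕ) : Type _ := K W j

instance (j : ℕ) : NormedAddCommGroup (KFib W j) := inferInstanceAs (NormedAddCommGroup (K W j))

instance (j : ℕ) : NormedSpace ℝ (KFib W j) := inferInstanceAs (NormedSpace ℝ (K W j))

instance [FiniteDimensional ℝ V] (j : ℕ) : FiniteDimensional ℝ (KFib W j) :=
  inferInstanceAs (FiniteDimensional ℝ (K W j))

/-- The inclusion `K_{j+1} → ∧^{j+1} V^* ⊗ V`. -/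
def inclFib (j : ℕ) : KFib W j →L[ℝ] Alt V (j + 1) := (K W j).subtypeL

/-- `Γ(K_{j+1})` as a submodule of `Γ(∧^{j+1} V^* ⊗ V)`. -/
def secK (j : ℕ) : Submodule (SmoothFun V) (Sec V (Alt V (j + 1))) where
  carrier := {s | ∀ x, s x ∈ K W j}
  zero_mem' := fun _ => (K W j).zero_mem
  add_mem' := fun hs ht x => (K W j).add_mem (hs x) (ht x)
  smul_mem' := fun f _ hs x => (K W j).smul_mem (f x) (hs x)

/-- The inclusion `Γ(K_{j+1}) → Γ(∧^{j+1} V^* ⊗ V)`. -/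
def inclK (j : ℕ) : Sec V (KFib W j) →ₗ[SmoothFun V] Sec V (Alt V (j + 1)) :=
  mapSec (inclFib W j)

/-- The inclusion `Γ(K_•) → Γ(∧^• V^* ⊗ V)`. -/
def inclGr : GrSec V (KFib W) →+ GrSec V (AltFib V) :=
  DirectSum.map fun j => (inclK W j).toAddMonoidHom

end Subspace

end SubspaceFoliation

end

open SubspaceFoliation

/-! Algebra. With `circ s t` = i_s t + ρ(s)(t), the Nijenhuis–Richardson bracket is the graded
commutator of `circ`, and `circ` is graded pre-Lie: its associator is symmetric in the first two
arguments (`circGr_preLie`). That associator is the one of the pointwise insertion product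
(`assoc_symm`) plus terms in the first and second derivatives of the last argument, which are
visibly symmetric; the graded Jacobi identity follows formally. The Koszul differential is a
derivation of `circ` (`koszulGr_circGr`), hence of the bracket. To avoid sums over shuffles and
degree casts, forms are treated as functions on lists of vectors, and insertion is defined by
recursion on the first vector; `ev_insertion` identifies it with the shuffle formula.

Exactness. Let P be a projection with kernel W. Scaling along the range of P yields a Poincaré-type
homotopy for the contraction with the Euler field (`exists_koszul_eq`). A cycle θ in Γ(K) splits as
(1 - P)θ + Pθ. The first part has values in W, so any primitive composed with 1 - P lies in K. The
second vanishes as soon as one argument lies in W, and the homotopy along P preserves this property.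
Both primitives together give `exists_koszul_eq_of_mem`, whose case of 0-forms is the surjectivity
of ρ onto the foliation.

All operations preserve Γ(K). Since K has a constant fibre, a linear retraction carries them to
sections of `KFib`, and every identity follows from the injectivity of the inclusion. -/

noncomputable section

namespace SubspaceFoliation

/-! ### Insertion of vector-valued forms as a graded pre-Lie product -/

section ListForms

set_option linter.unusedSectionVars false

variable {V : Type*} [AddCommGroup V] [Module ℝ V]

/-- Contraction with a vector in the first slot of a form, forms of all degrees being encoded as a
function on lists of vectors. -/
def contr (v : V) (f : List V → V) : List V → V := fun l => f (v :: l)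

/-- The grading involution, with degrees shifted by one. -/
def bar (f : List V → V) : List V → V := fun l => (-1 : ℝ) ^ (l.length + 1) • f l

/-- The insertion product of vector-valued forms; contraction is a graded derivation of it. -/
def ins : (List V → V) → (List V → V) → List V → V
  | φ, ψ, [] => ψ [φ []]
  | φ, ψ, v :: l => ins (contr v φ) ψ l + ins (bar φ) (contr v ψ) l

/-- Multilinear functions on lists. -/
def IsMulti (f : List V → V) : Prop := ∀ l₁ l₂, IsLinearMap ℝ fun x => f (l₁ ++ x :: l₂)

/-- Multilinear alternating functions on lists. -/
structure IsAlt (f : List V → V) : Prop where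
  linear : IsMulti f
  swap : ∀ l₁ l₂ x y, f (l₁ ++ x :: y :: l₂) = -f (l₁ ++ y :: x :: l₂)

/-- `f` is homogeneous of the parity of `a`. -/
def Par (a : ℕ) (f : List V → V) : Prop := bar f = (-1 : ℝ) ^ a • f

@[simp] theorem contr_apply (v : V) (f : List V → V) (l : List V) : contr v f l = f (v :: l) := rfl

theorem bar_apply (f : List V → V) (l : List V) : bar f l = (-1 : ℝ) ^ (l.length + 1) • f l := rfl

@[simp] theorem ins_nil (φ ψ : List V → V) : ins φ ψ [] = ψ [φ []] := by rw [ins]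

theorem ins_cons (φ ψ : List V → V) (v : V) (l : List V) :
    ins φ ψ (v :: l) = ins (contr v φ) ψ l + ins (bar φ) (contr v ψ) l := by rw [ins]

theorem contr_add (v : V) (f g : List V → V) : contr v (f + g) = contr v f + contr v g := rfl

theorem contr_smul (v : V) (c : ℝ) (f : List V → V) : contr v (c • f) = c • contr v f := rfl

/-- For φ of degree p the sign in `bar` is (-1)^(p+1): v passes the p arguments of φ and then the
slot of ψ that φ occupies. -/
theorem contr_ins (v : V) (φ ψ : List V → V) :
    contr v (ins φ ψ) = ins (contr v φ) ψ + ins (bar φ) (contr v ψ) :=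
  funext fun l => ins_cons φ ψ v l

theorem bar_add (f g : List V → V) : bar (f + g) = bar f + bar g :=
  funext fun _ => smul_add _ _ _

theorem bar_smul (c : ℝ) (f : List V → V) : bar (c • f) = c • bar f :=
  funext fun _ => smul_comm _ _ _

theorem bar_contr (v : V) (f : List V → V) : bar (contr v f) = (-1 : ℝ) • contr v (bar f) := by
  funext l
  simp only [bar_apply, contr_apply, Pi.smul_apply, smul_smul, List.length_cons, pow_succ]
  congr 1
  ring

theorem contr_bar (v : V) (f : List V → V) : contr v (bar f) = (-1 : ℝ) • bar (contr v f) := by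
  rw [bar_contr, smul_smul]; simp

theorem IsMulti.contraction {f : List V → V} (hf : IsMulti f) (v : V) : IsMulti (contr v f) :=
  fun l₁ l₂ => hf (v :: l₁) l₂

theorem IsMulti.involution {f : List V → V} (hf : IsMulti f) : IsMulti (bar f) := by
  refine fun l₁ l₂ => ⟨fun x y => ?_, fun c x => ?_⟩
  · simp only [bar_apply, (hf l₁ l₂).map_add, List.length_append, List.length_cons, smul_add]
  · simp only [bar_apply, (hf l₁ l₂).map_smul, List.length_append, List.length_cons]
    rw [smul_comm]

theorem IsMulti.singleton {f : List V → V} (hf : IsMulti f) : IsLinearMap ℝ fun x => f [x] :=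
  hf [] []

theorem IsMulti.contr_add {f : List V → V} (hf : IsMulti f) (x y : V) :
    contr (x + y) f = contr x f + contr y f :=
  funext fun l => (hf [] l).map_add x y

theorem IsMulti.contr_smul {f : List V → V} (hf : IsMulti f) (c : ℝ) (x : V) :
    contr (c • x) f = c • contr x f :=
  funext fun l => (hf [] l).map_smul c x

theorem IsAlt.contraction {f : List V → V} (hf : IsAlt f) (v : V) : IsAlt (contr v f) :=
  ⟨hf.linear.contraction v, fun l₁ l₂ => hf.swap (v :: l₁) l₂⟩

theorem Par.contraction {a : ℕ} {f : List V → V} (hf : Par a f) (v : V) : Par (a + 1) (contr v f) := by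
  rw [Par, bar_contr, hf, contr_smul, smul_smul, pow_succ']

/-- On lists of length m the involution is multiplication by (-1)^(m+1), which here is opposite to
(-1)^a, so the value equals its own negative. -/
theorem Par.eq_zero {a : ℕ} {f : List V → V} (hf : Par a f) {l : List V} (h : Even (a + l.length)) :
    f l = 0 := by
  have h1 := congrFun hf l
  rw [bar_apply, Pi.smul_apply] at h1
  have h2 : ((-1 : ℝ) ^ a * (-1) ^ (l.length + 1)) • f l = ((-1 : ℝ) ^ a * (-1) ^ a) • f l := by
    rw [mul_smul, h1, mul_smul]
  rw [← pow_add, ← pow_add, ← add_assoc, pow_succ, h.neg_one_pow, (Even.add_self a).neg_one_pow] at h2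
  simp only [one_mul, neg_smul, one_smul] at h2
  have h3 : (2 : ℝ) • f l = 0 := by rw [two_smul]; nth_rewrite 1 [← h2]; simp
  exact (smul_eq_zero.mp h3).resolve_left two_ne_zero

theorem ins_add_right (φ ψ ψ' : List V → V) : ins φ (ψ + ψ') = ins φ ψ + ins φ ψ' := by
  funext l
  induction l generalizing φ ψ ψ' with
  | nil => simp
  | cons v l ih =>
    simp only [ins_cons, contr_add, ih, Pi.add_apply]
    abel

theorem ins_smul_right (c : ℝ) (φ ψ : List V → V) : ins φ (c • ψ) = c • ins φ ψ := by
  funext l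
  induction l generalizing φ ψ with
  | nil => simp
  | cons v l ih => simp only [ins_cons, contr_smul, ih, Pi.smul_apply, smul_add]

theorem ins_add_left (φ φ' : List V → V) {ψ : List V → V} (hψ : IsMulti ψ) :
    ins (φ + φ') ψ = ins φ ψ + ins φ' ψ := by
  funext l
  induction l generalizing φ φ' ψ with
  | nil => exact hψ.singleton.map_add _ _
  | cons v l ih =>
    simp only [ins_cons, contr_add, bar_add, ih _ _ hψ, ih _ _ (hψ.contraction v), Pi.add_apply]
    abel

theorem ins_smul_left (c : ℝ) (φ : List V → V) {ψ : List V → V} (hψ : IsMulti ψ) :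
    ins (c • φ) ψ = c • ins φ ψ := by
  funext l
  induction l generalizing φ ψ with
  | nil => exact hψ.singleton.map_smul _ _
  | cons v l ih =>
    simp only [ins_cons, contr_smul, bar_smul, ih _ hψ, ih _ (hψ.contraction v), Pi.smul_apply, smul_add]

theorem bar_ins (φ : List V → V) {ψ : List V → V} (hψ : IsMulti ψ) :
    bar (ins φ ψ) = ins (bar φ) (bar ψ) := by
  funext l
  induction l generalizing φ ψ with
  | nil => simp [bar_apply, hψ.singleton.map_neg]
  | cons v l ih =>
    rw [← contr_apply v (bar (ins φ ψ)), contr_bar, contr_ins, bar_add, ins_cons, contr_bar, contr_bar,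
      ins_smul_left _ _ hψ.involution, ins_smul_right, smul_add]
    simp only [Pi.add_apply, Pi.smul_apply, ih _ hψ, ih _ (hψ.contraction v)]

theorem ins_zero_left {ψ : List V → V} (hψ : IsMulti ψ) : ins 0 ψ = 0 := by
  simpa using ins_smul_left 0 0 hψ

theorem IsMulti.insertion {φ ψ : List V → V} (hφ : IsMulti φ) (hψ : IsMulti ψ) :
    IsMulti (ins φ ψ) := by
  intro l₁ l₂
  induction l₁ generalizing φ ψ with
  | nil =>
    refine ⟨fun x y => ?_, fun c x => ?_⟩
    · simp only [List.nil_append, ins_cons, hφ.contr_add, hψ.contr_add, ins_add_left _ _ hψ,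
        ins_add_right, Pi.add_apply]
      abel
    · simp only [List.nil_append, ins_cons, hφ.contr_smul, hψ.contr_smul, ins_smul_left _ _ hψ,
        ins_smul_right, Pi.smul_apply, smul_add]
  | cons v l ih =>
    simp only [List.cons_append, ins_cons]
    exact (IsLinearMap.mk' _ (ih (hφ.contraction v) hψ) +
      IsLinearMap.mk' _ (ih hφ.involution (hψ.contraction v))).isLinear

/-- Insertion of a vector, that is, of a form of degree `0`. -/
theorem ins_of_contr_left {φ : List V → V} (hφ : ∀ v, contr v φ = 0) {ψ : List V → V}
    (hψ : IsAlt ψ) (l : List V) : ins φ ψ l = ψ (φ [] :: l) := by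
  induction l generalizing φ ψ with
  | nil => simp
  | cons v l ih =>
    have h : bar φ [] = (-1 : ℝ) • φ [] := by simp [bar_apply]
    rw [ins_cons, hφ, ins_zero_left hψ.linear, ih (fun w => ?_) (hψ.contraction v)]
    -- The sign of `bar` on a vector cancels the sign of exchanging v with that vector inside ψ.
    · have h1 := (hψ.linear [v] l).map_smul (-1) (φ [])
      have h2 := hψ.swap [] l v (φ [])
      simp only [List.singleton_append, List.nil_append] at h1 h2
      rw [h, contr_apply, h1, h2]
      simp
    · rw [contr_bar, hφ]
      funext l
      simp [bar_apply]

/-- Insertion into a form of degree `0`. -/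
theorem ins_of_contr_right (φ : List V → V) {ψ : List V → V} (hψ : ∀ v, contr v ψ = 0) :
    ins φ ψ = 0 := by
  funext l
  induction l generalizing φ ψ with
  | nil => exact congrFun (hψ _) []
  | cons v l ih =>
    rw [ins_cons, ih _ hψ, hψ v, ih _ fun w => rfl]
    simp

/-- The associator of the insertion product. -/
def assoc (φ ψ χ : List V → V) : List V → V := ins φ (ins ψ χ) - ins (ins φ ψ) χ

/-- Contraction is a graded derivation of the product, hence of the associator. This lets statements
about associators be proved by induction on the list. -/
theorem assoc_cons {a b : ℕ} {φ ψ χ : List V → V} (hφ : Par a φ) (hψ : Par b ψ)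
    (hψ' : IsMulti ψ) (hχ : IsMulti χ) (v : V) (l : List V) :
    assoc φ ψ χ (v :: l) = assoc (contr v φ) ψ χ l + (-1 : ℝ) ^ a • assoc φ (contr v ψ) χ l +
      (-1 : ℝ) ^ (a + b) • assoc φ ψ (contr v χ) l := by
  have h1 : bar (ins φ ψ) = (-1 : ℝ) ^ (a + b) • ins φ ψ := by
    rw [bar_ins φ hψ', hφ, hψ, ins_smul_left _ _ (hψ ▸ hψ'.involution), ins_smul_right, smul_smul,
      pow_add]
  have hc := hχ.contraction v
  have hψc := hψ'.contraction v
  simp only [assoc, Pi.sub_apply, ins_cons, contr_ins, h1, ins_add_left _ _ hχ,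
    ins_add_right]
  rw [hφ, hψ]
  simp only [ins_smul_left _ _ hχ, ins_smul_left _ _ hc, ins_smul_left _ _ hψc,
    ins_smul_left _ _ (hψc.insertion hχ), ins_smul_left _ _ (hψ'.insertion hc), ins_smul_right,
    Pi.add_apply, Pi.smul_apply, smul_sub, pow_add, mul_smul]
  module

/-- The insertion product is a graded left-symmetric (pre-Lie) product. -/
theorem assoc_symm {a b : ℕ} {φ ψ χ : List V → V} (hφ : Par a φ) (hψ : Par b ψ)
    (hφ' : IsMulti φ) (hψ' : IsMulti ψ) (hχ : IsAlt χ) :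
    assoc φ ψ χ = (-1 : ℝ) ^ (a * b) • assoc ψ φ χ := by
  funext l
  induction l generalizing a b φ ψ χ with
  | nil =>
    -- On the empty list the terms χ [ψ [φ []]] cancel. The remaining value can be nonzero only if a
    -- and b are both odd, and then the antisymmetry of χ supplies the sign (-1)^(ab) = -1.
    have key : ∀ φ ψ : List V → V, assoc φ ψ χ [] = -χ [φ [], ψ []] := by
      intro φ ψ
      have h : bar ψ [] = (-1 : ℝ) • ψ [] := by simp [bar_apply]
      have h2 := (hχ.linear [φ []] []).map_smul (-1) (ψ [])
      simp only [List.singleton_append] at h2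
      simp only [assoc, Pi.sub_apply, ins_nil, ins_cons, contr_apply, h, h2]
      simp
    rw [Pi.smul_apply, key, key]
    have hs := hχ.swap [] [] (φ []) (ψ [])
    simp only [List.nil_append] at hs
    rcases Nat.even_or_odd a with ha | ha
    · have h0 : φ [] = 0 := hφ.eq_zero (by simpa using ha)
      have h1 := (hχ.linear [ψ []] []).map_zero
      simp only [List.singleton_append] at h1
      rw [hs, h0, h1]
      simp
    · rcases Nat.even_or_odd b with hb | hb
      · have h0 : ψ [] = 0 := hψ.eq_zero (by simpa using hb)
        have h1 := (hχ.linear [φ []] []).map_zero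
        simp only [List.singleton_append] at h1
        rw [← neg_eq_iff_eq_neg] at hs
        rw [← hs, h0, h1]
        simp
      · rw [(ha.mul hb).neg_one_pow, hs]
        simp
  | cons v l ih =>
    -- The three Leibniz terms on the two sides match in pairs. Contracting an argument raises its
    -- index by one, and `e1`, `e2` absorb the resulting change of sign.
    rw [Pi.smul_apply, assoc_cons hφ hψ hψ' hχ.linear, assoc_cons hψ hφ hφ' hχ.linear,
      ih (hφ.contraction v) hψ (hφ'.contraction v) hψ' hχ, ih hφ (hψ.contraction v) hφ' (hψ'.contraction v) hχ,
      ih hφ hψ hφ' hψ' (hχ.contraction v)]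
    simp only [Pi.smul_apply, smul_add, smul_smul, ← pow_add]
    rw [add_comm (_ • assoc ψ (contr v φ) χ l)]
    have e1 : (-1 : ℝ) ^ ((a + 1) * b) = (-1) ^ (a * b + b) := by congr 1; ring
    have e2 : (-1 : ℝ) ^ (a + a * (b + 1)) = (-1) ^ (a * b) := by
      rw [show a + a * (b + 1) = a * b + 2 * a by ring, pow_add, pow_mul _ 2]; simp
    rw [e1, e2, show a + b + a * b = a * b + (b + a) by ring]

end ListForms

/-! ### Recursive insertion agrees with alternatization over all permutations -/

section Alternatization

set_option linter.unusedSectionVars false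

variable {V : Type*} [AddCommGroup V] [Module ℝ V]

/-- The alternatization of a function on lists, at an `n`-tuple. -/
def altSum (n : ℕ) (g : List V → V) (u : Fin n → V) : V :=
  ∑ σ : Equiv.Perm (Fin n), Equiv.Perm.sign σ • g (List.ofFn (u ∘ σ))

/-- Insertion of a form without antisymmetrization: `φ` is fed with the first `p` vectors. -/
def blockIns (p : ℕ) (φ ψ : List V → V) : List V → V := fun l => ψ (φ (l.take p) :: l.drop p)

/-- `f` is concentrated in form degree `p`. -/
def Supp (p : ℕ) (f : List V → V) : Prop := ∀ l, l.length ≠ p → f l = 0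

theorem Supp.contraction {p : ℕ} {f : List V → V} (hf : Supp (p + 1) f) (v : V) :
    Supp p (contr v f) := fun l hl => hf _ (by simpa using hl)

theorem Supp.contr_eq_zero {f : List V → V} (hf : Supp 0 f) (v : V) : contr v f = 0 :=
  funext fun l => hf _ (by simp)

theorem Supp.involution {p : ℕ} {f : List V → V} (hf : Supp p f) : Supp p (bar f) :=
  fun l hl => by rw [bar_apply, hf l hl, smul_zero]

theorem Supp.insertion {p q : ℕ} {φ ψ : List V → V} (hφ : Supp p φ) (hψ : Supp (q + 1) ψ)
    (hψ' : IsMulti ψ) : Supp (p + q) (ins φ ψ) := by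
  intro l hl
  induction l generalizing p q φ ψ with
  | nil =>
    rw [ins_nil]
    by_cases hp : p = 0
    · exact hψ _ (by simp at hl ⊢; omega)
    · rw [hφ _ (by simpa using Ne.symm hp)]
      exact hψ'.singleton.map_zero
  | cons v l ih =>
    rw [ins_cons]
    have h1 : ins (contr v φ) ψ l = 0 := by
      cases p with
      | zero => rw [hφ.contr_eq_zero, ins_zero_left hψ']; rfl
      | succ p => exact ih (hφ.contraction v) hψ hψ' (by simp at hl; omega)
    have h2 : ins (bar φ) (contr v ψ) l = 0 := by
      cases q with
      | zero => rw [ins_of_contr_right _ fun w => (hψ.contraction v).contr_eq_zero w]; rfl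
      | succ q =>
        exact ih hφ.involution (hψ.contraction v) (hψ'.contraction v) (by simp at hl; omega)
    rw [h1, h2, add_zero]

theorem Supp.bar_eq {p : ℕ} {f : List V → V} (hf : Supp p f) : bar f = (-1 : ℝ) ^ (p + 1) • f := by
  funext l
  by_cases h : l.length = p
  · rw [bar_apply, h]; rfl
  · rw [bar_apply, Pi.smul_apply, hf l h, smul_zero, smul_zero]

theorem ofFn_insertNth {n : ℕ} (p : Fin (n + 1)) (v : V) (w : Fin n → V) :
    List.ofFn (p.insertNth v w : Fin (n + 1) → V) = (List.ofFn w).insertIdx p v := by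
  apply List.ext_getElem
  · rw [List.length_insertIdx_of_le_length (by simp; omega)]; simp
  · intro i h1 h2
    have hi : i < n + 1 := by simpa using h1
    rw [List.getElem_ofFn, List.getElem_insertIdx]
    rcases lt_trichotomy i p with h | h | h
    · rw [dif_pos h, List.getElem_ofFn]
      have : (⟨i, hi⟩ : Fin (n + 1)) = p.succAbove ⟨i, by omega⟩ := by
        rw [Fin.succAbove_of_castSucc_lt _ _ (by simpa [Fin.lt_def] using h)]; rfl
      rw [this, Fin.insertNth_apply_succAbove]
    · rw [dif_neg (by omega), dif_pos h]
      have : (⟨i, hi⟩ : Fin (n + 1)) = p := Fin.ext h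
      rw [this, Fin.insertNth_apply_same]
    · rw [dif_neg (by omega), dif_neg (by omega), List.getElem_ofFn]
      have : (⟨i, hi⟩ : Fin (n + 1)) = p.succAbove ⟨i - 1, by omega⟩ := by
        rw [Fin.succAbove_of_le_castSucc _ _ (by simp only [Fin.le_def, Fin.val_castSucc]; omega)]
        ext; simp; omega
      rw [this, Fin.insertNth_apply_succAbove]

/-- A permutation amounts to the position p that it sends to 0 together with a permutation of the
rest: the composite sends p to 0, so p can be recovered and cancelled, and the cardinalities agree.
-/
theorem bijective_insert_perm (n : ℕ) :
    Function.Bijective fun q : Fin (n + 1) × Equiv.Perm (Fin n) =>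
      Equiv.Perm.decomposeFin.symm (0, q.2) * q.1.cycleRange := by
  rw [Fintype.bijective_iff_injective_and_card]
  refine ⟨?_, ?_⟩
  · rintro ⟨p, e⟩ ⟨p', e'⟩ h
    have h0 : ∀ (p : Fin (n + 1)) (e : Equiv.Perm (Fin n)),
        (Equiv.Perm.decomposeFin.symm (0, e) * p.cycleRange) p = 0 := by
      intro p e
      simp [Equiv.Perm.mul_apply]
    have hp : p = p' := by
      have h1 := h0 p e
      have h2 := h0 p' e'
      simp only at h
      rw [h] at h1
      exact Equiv.injective _ (h1.trans h2.symm)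
    subst hp
    simp only [mul_left_inj, EmbeddingLike.apply_eq_iff_eq, Prod.mk.injEq, true_and] at h
    rw [h]
  · simp [Fintype.card_perm, Nat.factorial_succ]

/-- Laplace expansion: permutations are sorted by the position p where v lands, and the cycle moving
it there has sign (-1)^p. -/
theorem altSum_cons (n : ℕ) (g : List V → V) (v : V) (u : Fin n → V) :
    altSum (n + 1) g (Fin.cons v u) =
      ∑ p : Fin (n + 1), (-1 : ℝ) ^ (p : ℕ) • altSum n (fun l => g (l.insertIdx p v)) u := by
  rw [altSum, ← (Equiv.ofBijective _ (bijective_insert_perm n)).sum_comp, Fintype.sum_prod_type]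
  refine Finset.sum_congr rfl fun p _ => ?_
  rw [altSum, Finset.smul_sum]
  refine Finset.sum_congr rfl fun e _ => ?_
  have h1 : (Fin.cons v u : Fin (n + 1) → V) ∘
      (Equiv.Perm.decomposeFin.symm (0, e) * p.cycleRange) = p.insertNth v (u ∘ e) := by
    rw [← Fin.cons_comp_cycleRange, Equiv.Perm.coe_mul, ← Function.comp_assoc]
    congr 1
    funext i
    refine Fin.cases ?_ (fun i => ?_) i <;> simp
  have h2 : Equiv.Perm.sign (Equiv.Perm.decomposeFin.symm (0, e) * p.cycleRange) =
      (-1) ^ (p : ℕ) * Equiv.Perm.sign e := by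
    rw [Equiv.Perm.sign_mul, Fin.sign_cycleRange, Equiv.Perm.decomposeFin.symm_sign, if_pos rfl,
      one_mul, mul_comm]
  simp only [Equiv.ofBijective_apply, h1, h2, ofFn_insertNth]
  rcases Nat.even_or_odd (p : ℕ) with h | h
  · simp [h.neg_one_pow]
  · simp [h.neg_one_pow]

theorem IsAlt.insertIdx {f : List V → V} (hf : IsAlt f) (v : V) {l : List V} {k : ℕ}
    (hk : k ≤ l.length) : f (l.insertIdx k v) = (-1 : ℝ) ^ k • f (v :: l) := by
  induction k generalizing l f with
  | zero => simp
  | succ k ih =>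
    cases l with
    | nil => simp at hk
    | cons a l =>
      rw [List.insertIdx_succ_cons, ← contr_apply a f, ih (hf.contraction a) (by simpa using hk)]
      have := hf.swap [] l a v
      simp only [List.nil_append] at this
      rw [contr_apply, this, pow_succ]
      simp

theorem take_succ_insertIdx (v : V) {l : List V} {k p : ℕ} (hk : k ≤ p) (hp : p ≤ l.length) :
    (l.insertIdx k v).take (p + 1) = (l.take p).insertIdx k v := by
  induction k generalizing l p with
  | zero => simp
  | succ k ih =>
    obtain ⟨p, rfl⟩ : ∃ p', p = p' + 1 := ⟨p - 1, by omega⟩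
    cases l with
    | nil => simp at hp
    | cons a l => simp [ih (l := l) (p := p) (by omega) (by simpa using hp)]

theorem drop_succ_insertIdx (v : V) {l : List V} {k p : ℕ} (hk : k ≤ p) (hp : p ≤ l.length) :
    (l.insertIdx k v).drop (p + 1) = l.drop p := by
  induction k generalizing l p with
  | zero => simp
  | succ k ih =>
    obtain ⟨p, rfl⟩ : ∃ p', p = p' + 1 := ⟨p - 1, by omega⟩
    cases l with
    | nil => simp at hp
    | cons a l => simp [ih (l := l) (p := p) (by omega) (by simpa using hp)]

theorem take_insertIdx_add (v : V) {l : List V} {j p : ℕ} (hp : p + j ≤ l.length) :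
    (l.insertIdx (p + j) v).take p = l.take p := by
  induction p generalizing l with
  | zero => simp
  | succ p ih =>
    cases l with
    | nil => simp at hp
    | cons a l =>
      rw [Nat.add_right_comm]
      simp [ih (l := l) (by simp at hp; omega)]

theorem drop_insertIdx_add (v : V) {l : List V} {j p : ℕ} (hp : p + j ≤ l.length) :
    (l.insertIdx (p + j) v).drop p = (l.drop p).insertIdx j v := by
  induction p generalizing l with
  | zero => simp
  | succ p ih =>
    cases l with
    | nil => simp at hp
    | cons a l =>
      rw [Nat.add_right_comm]
      simp [ih (l := l) (by simp at hp; omega)]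

theorem blockIns_insertIdx_of_le {φ ψ : List V → V} (hφ : IsAlt φ) (hψ : IsAlt ψ) (v : V)
    {l : List V} {k p : ℕ} (hk : k ≤ p) (hp : p ≤ l.length) :
    blockIns (p + 1) φ ψ (l.insertIdx k v) = (-1 : ℝ) ^ k • blockIns p (contr v φ) ψ l := by
  have h1 : (l.insertIdx k v).take (p + 1) = (l.take p).insertIdx k v := take_succ_insertIdx v hk hp
  have h2 : (l.insertIdx k v).drop (p + 1) = l.drop p := drop_succ_insertIdx v hk hp
  rw [blockIns, h1, h2, hφ.insertIdx v (by simp; omega)]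
  exact (hψ.linear [] _).map_smul _ _

theorem blockIns_insertIdx_add {φ ψ : List V → V} (hψ : IsAlt ψ) (v : V)
    {l : List V} {j p : ℕ} (hp : p + j ≤ l.length) :
    blockIns p φ ψ (l.insertIdx (p + j) v) = (-1 : ℝ) ^ (j + 1) • blockIns p φ (contr v ψ) l := by
  have h1 : (l.insertIdx (p + j) v).take p = l.take p := take_insertIdx_add v hp
  have h2 : (l.insertIdx (p + j) v).drop p = (l.drop p).insertIdx j v := drop_insertIdx_add v hp
  have h3 := hψ.swap [] (l.drop p) (φ (l.take p)) v
  simp only [List.nil_append] at h3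
  rw [blockIns, h1, h2, ← contr_apply _ ψ, (hψ.contraction _).insertIdx v (by simp; omega), contr_apply, h3,
    blockIns, contr_apply, pow_succ]
  simp

theorem altSum_smul (n : ℕ) (c : ℝ) (g : List V → V) (u : Fin n → V) :
    altSum n (c • g) u = c • altSum n g u := by
  rw [altSum, altSum, Finset.smul_sum]
  exact Finset.sum_congr rfl fun σ _ => smul_comm _ _ _

theorem altSum_congr {n : ℕ} {g g' : List V → V} (h : ∀ l, l.length = n → g l = g' l)
    (u : Fin n → V) : altSum n g u = altSum n g' u :=
  Finset.sum_congr rfl fun σ _ => by rw [h _ (by simp)]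

/-- The p positions inside the block of φ contribute equally, since moving v to the front of φ
undoes the sign (-1)^k of the cycle. Each of the q later positions p + k leaves (-1)^(p+1): the
moves inside ψ give (-1)^k, and passing the slot of φ gives one more sign. The truncated p - 1 is
harmless because its coefficient is p. -/
theorem altSum_blockIns_cons {φ ψ : List V → V} (hφ : IsAlt φ) (hψ : IsAlt ψ) {p q n : ℕ}
    (h : p + q = n + 1) (v : V) (u : Fin n → V) :
    altSum (n + 1) (blockIns p φ ψ) (Fin.cons v u) =
      (p : ℝ) • altSum n (blockIns (p - 1) (contr v φ) ψ) u +
        ((q : ℝ) * (-1) ^ (p + 1)) • altSum n (blockIns p φ (contr v ψ)) u := by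
  rw [altSum_cons, ← (finCongr h).sum_comp, Fin.sum_univ_add]
  congr 1
  · rw [Nat.cast_smul_eq_nsmul ℝ]
    conv_rhs => rw [← Fintype.card_fin p, ← Finset.card_univ, ← Finset.sum_const]
    refine Finset.sum_congr rfl fun k _ => ?_
    obtain ⟨p, rfl⟩ : ∃ p', p = p' + 1 := ⟨p - 1, by have := k.2; omega⟩
    have hk := k.2
    simp only [finCongr_apply, Fin.val_cast, Fin.val_castAdd, Fintype.card_fin, Finset.card_univ]
    rw [altSum_congr (g' := (-1 : ℝ) ^ (k : ℕ) • blockIns p (contr v φ) ψ)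
      (fun l hl => blockIns_insertIdx_of_le hφ hψ v (by omega) (by omega)), altSum_smul, smul_smul,
      ← pow_add, (Even.add_self _).neg_one_pow, one_smul]
    rfl
  · rw [mul_smul, Nat.cast_smul_eq_nsmul ℝ]
    conv_rhs => rw [← Fintype.card_fin q, ← Finset.card_univ, ← Finset.sum_const]
    refine Finset.sum_congr rfl fun k _ => ?_
    have hk := k.2
    simp only [finCongr_apply, Fin.val_cast, Fin.val_natAdd]
    rw [altSum_congr (g' := (-1 : ℝ) ^ ((k : ℕ) + 1) • blockIns p φ (contr v ψ))
      (fun l hl => blockIns_insertIdx_add hψ v (by omega)), altSum_smul, smul_smul,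
      ← pow_add, show p + (k : ℕ) + (k + 1) = (p + 1) + (k + k) by ring, pow_add,
      (Even.add_self _).neg_one_pow, mul_one]

/-- Both sides obey the same recursion in the first vector; the factors p and q of
`altSum_blockIns_cons` build up the factorials. -/
theorem altSum_blockIns {φ ψ : List V → V} (hφ : IsAlt φ) (hψ : IsAlt ψ) {p q n : ℕ}
    (hp : Supp p φ) (hq : Supp (q + 1) ψ) (h : p + q = n) (u : Fin n → V) :
    altSum n (blockIns p φ ψ) u =
      ((p.factorial * q.factorial : ℕ) : ℝ) • ins φ ψ (List.ofFn u) := by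
  induction n generalizing p q φ ψ with
  | zero =>
    obtain ⟨rfl, rfl⟩ : p = 0 ∧ q = 0 := by omega
    simp [altSum, blockIns]
  | succ n ih =>
    obtain ⟨v, u, rfl⟩ : ∃ v u', u = Fin.cons v u' := ⟨u 0, Fin.tail u, (Fin.cons_self_tail u).symm⟩
    rw [altSum_blockIns_cons hφ hψ h, List.ofFn_succ]
    simp only [Fin.cons_zero, Fin.cons_succ]
    rw [ins_cons, hp.bar_eq, ins_smul_left _ _ (hψ.contraction v).linear, smul_add]
    congr 1
    · cases p with
      | zero => rw [hp.contr_eq_zero, ins_zero_left hψ.linear]; simp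
      | succ p =>
        rw [Nat.add_sub_cancel, ih (hφ.contraction v) hψ (hp.contraction v) hq (by omega), smul_smul,
          Nat.factorial_succ]
        push_cast
        congr 1
        ring
    · cases q with
      | zero => rw [ins_of_contr_right _ fun w => (hq.contraction v).contr_eq_zero w]; simp
      | succ q =>
        rw [ih hφ (hψ.contraction v) hp (hq.contraction v) (by omega), smul_smul, Pi.smul_apply,
          smul_smul, Nat.factorial_succ q]
        push_cast
        congr 1
        ring

end Alternatization

/-! ### Alternating maps as functions on lists -/

section Evaluation

variable {V : Type*} [NormedAddCommGroup V] [NormedSpace ℝ V]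

set_option linter.unusedSectionVars false

/-- An alternating map as a function on lists. -/
def ev {n : ℕ} (φ : Alt V n) : List V → V :=
  fun l => if h : l.length = n then φ fun i => l.get (i.cast h.symm) else 0

theorem ev_ofFn {n : ℕ} (φ : Alt V n) (v : Fin n → V) : ev φ (List.ofFn v) = φ v := by
  rw [ev, dif_pos (List.length_ofFn)]
  congr 1
  funext i
  simp

theorem exists_ofFn {n : ℕ} {l : List V} (h : l.length = n) : ∃ v : Fin n → V, l = List.ofFn v := by
  subst h
  exact ⟨l.get, (List.ofFn_get l).symm⟩

theorem supp_ev {n : ℕ} (φ : Alt V n) : Supp n (ev φ) := fun _ hl => dif_neg hl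

theorem ev_injective {n : ℕ} : Function.Injective (ev : Alt V n → List V → V) := by
  intro φ ψ h
  ext v
  rw [← ev_ofFn, ← ev_ofFn, h]

theorem ev_add {n : ℕ} (φ ψ : Alt V n) : ev (φ + ψ) = ev φ + ev ψ := by
  funext l
  by_cases h : l.length = n
  · obtain ⟨v, rfl⟩ := exists_ofFn h
    simp [ev_ofFn]
  · simp [supp_ev _ l h]

theorem ev_smul {n : ℕ} (c : ℝ) (φ : Alt V n) : ev (c • φ) = c • ev φ := by
  funext l
  by_cases h : l.length = n
  · obtain ⟨v, rfl⟩ := exists_ofFn h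
    simp [ev_ofFn]
  · simp [supp_ev _ l h]

theorem contr_ev {n : ℕ} (φ : Alt V (n + 1)) (v : V) : contr v (ev φ) = ev (φ.curryLeft v) := by
  funext l
  by_cases h : l.length = n
  · obtain ⟨w, rfl⟩ := exists_ofFn h
    have : v :: List.ofFn w = List.ofFn (Fin.cons v w : Fin (n + 1) → V) := by simp
    rw [contr_apply, this, ev_ofFn, ev_ofFn]
    rfl
  · rw [supp_ev _ l h, contr_apply, supp_ev _ _ (by simpa using h)]

theorem par_ev {a : ℕ} (φ : Alt V (a + 1)) : Par a (ev φ) := by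
  rw [Par, (supp_ev φ).bar_eq, pow_add, pow_add]
  simp

theorem isAlt_ev {n : ℕ} (φ : Alt V n) : IsAlt (ev φ) := by
  have key : ∀ l₁ l₂ : List V, ∀ h : (l₁ ++ 0 :: l₂).length = n,
      ∃ (w : Fin n → V) (i : Fin n), ∀ x, l₁ ++ x :: l₂ = List.ofFn (Function.update w i x) := by
    intro l₁ l₂ h
    refine ⟨fun i => (l₁ ++ 0 :: l₂).get (i.cast h.symm), ⟨l₁.length, ?_⟩, fun x => ?_⟩
    · simp at h; omega
    · apply List.ext_getElem
      · simpa using h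
      · intro i h1 h2
        rw [List.getElem_ofFn, Function.update_apply]
        simp only [Fin.mk.injEq, List.get_eq_getElem, Fin.val_cast]
        grind
  refine ⟨fun l₁ l₂ => ?_, ?_⟩
  · by_cases h : (l₁ ++ 0 :: l₂).length = n
    · obtain ⟨w, i, hw⟩ := key l₁ l₂ h
      simp only [hw, ev_ofFn]
      exact ⟨fun x y => φ.map_update_add _ _ _ _, fun c x => φ.map_update_smul _ _ _ _⟩
    · have : ∀ x, ev φ (l₁ ++ x :: l₂) = 0 := fun x => supp_ev φ _ (by simpa using h)
      simp only [this]
      exact (0 : V →ₗ[ℝ] V).isLinear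
  · intro l₁ l₂ x y
    by_cases h : (l₁ ++ x :: y :: l₂).length = n
    · have hl : (l₁ ++ x :: y :: l₂).length = l₁.length + (l₂.length + 1 + 1) := by simp
      obtain ⟨w, hw⟩ := exists_ofFn h
      let i : Fin n := ⟨l₁.length, by omega⟩
      let j : Fin n := ⟨l₁.length + 1, by omega⟩
      have hij : i ≠ j := by simp [i, j, Fin.ext_iff]
      have hg : ∀ (m : ℕ) (hm : m < n), w ⟨m, hm⟩ = (l₁ ++ x :: y :: l₂)[m]'(by omega) := by
        intro m hm
        simp only [hw, List.getElem_ofFn]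
      have hw' : l₁ ++ y :: x :: l₂ = List.ofFn (w ∘ Equiv.swap i j) := by
        apply List.ext_getElem
        · simpa using h
        · intro m h1 h2
          rw [List.getElem_ofFn, Function.comp_apply]
          have hm : m < n := by simpa using h2
          rcases eq_or_ne m l₁.length with rfl | h3
          · rw [show (⟨l₁.length, hm⟩ : Fin n) = i from rfl, Equiv.swap_apply_left, hg]
            simp
          · rcases eq_or_ne m (l₁.length + 1) with rfl | h4
            · rw [show (⟨l₁.length + 1, hm⟩ : Fin n) = j from rfl, Equiv.swap_apply_right, hg]
              simp
            · rw [Equiv.swap_apply_of_ne_of_ne (by simpa [i, Fin.ext_iff] using h3)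
                (by simpa [j, Fin.ext_iff] using h4), hg]
              grind
      have hs : φ (w ∘ Equiv.swap i j) = -φ w := φ.toAlternatingMap.map_swap w hij
      rw [hw, hw', ev_ofFn, ev_ofFn, hs, neg_neg]
    · rw [supp_ev φ _ h, supp_ev φ _ (by simpa using h), neg_zero]

/-- The factor ((a+1)! b!)⁻¹ in the shuffle formula cancels the factorials of `altSum_blockIns`.
Identities for `insertion` can thus be checked on lists, where degrees need no casts. -/
theorem ev_insertion (a b : ℕ) (φ : Alt V (a + 1)) (ψ : Alt V (b + 1)) :
    ev (insertion a b φ ψ) = ins (ev φ) (ev ψ) := by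
  have hne : (((a + 1).factorial * b.factorial : ℕ) : ℝ) ≠ 0 := by positivity
  have key : ∀ v : Fin (a + b + 1) → V,
      ev (insertion a b φ ψ) (List.ofFn v) = ins (ev φ) (ev ψ) (List.ofFn v) := by
    intro v
    rw [ev_ofFn, insertion_apply, inv_smul_eq_iff₀ hne,
      ← altSum_blockIns (isAlt_ev φ) (isAlt_ev ψ) (supp_ev φ) (supp_ev ψ) (by omega), altSum]
    refine Finset.sum_congr rfl fun σ _ => congrArg _ ?_
    have h1 : (List.ofFn (v ∘ σ)).take (a + 1) = List.ofFn (v ∘ σ ∘ firstPos a b) := by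
      apply List.ext_getElem
      · simp
      · intro i h1 h2
        rw [List.getElem_take, List.getElem_ofFn, List.getElem_ofFn]
        rfl
    have h2 : ∀ x : V, x :: (List.ofFn (v ∘ σ)).drop (a + 1) =
        List.ofFn (Fin.cons x (v ∘ σ ∘ lastPos a b) : Fin (b + 1) → V) := by
      intro x
      rw [List.ofFn_cons]
      congr 1
      apply List.ext_getElem
      · simp
      · intro i h1 h2
        rw [List.getElem_drop, List.getElem_ofFn, List.getElem_ofFn]
        rfl
    rw [blockIns, h1, ev_ofFn, h2, ev_ofFn]
  funext l
  by_cases h : l.length = a + b + 1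
  · obtain ⟨v, rfl⟩ := exists_ofFn h
    exact key v
  · rw [supp_ev _ l h, (supp_ev φ).insertion (supp_ev ψ) (isAlt_ev ψ).linear l (by omega)]

end Evaluation

/-! ### Derivatives of sections, contractions and insertions -/

section SectionCalculus

variable {V : Type*} [NormedAddCommGroup V] [NormedSpace ℝ V]
variable {F : Type*} [NormedAddCommGroup F] [NormedSpace ℝ F]
variable {G : Type*} [NormedAddCommGroup G] [NormedSpace ℝ G]

@[simp] theorem coe_mkSec (f : V → F) (hf : ContDiff ℝ ∞ f) : ⇑(mkSec f hf) = f := rfl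

@[simp] theorem mapSec_apply (A : F →L[ℝ] G) (s : Sec V F) (x : V) : mapSec A s x = A (s x) := rfl

theorem Sec.differentiable (s : Sec V F) : Differentiable ℝ s :=
  s.contDiff.differentiable (by simp)

theorem Sec.differentiableAt (s : Sec V F) (x : V) : DifferentiableAt ℝ s x := s.differentiable x

theorem dirDeriv_apply (X : VecField V) (s : Sec V F) (x : V) :
    dirDeriv X s x = fderiv ℝ s x (X x) := rfl

theorem dirDeriv_add_left (X Y : VecField V) (s : Sec V F) :
    dirDeriv (X + Y) s = dirDeriv X s + dirDeriv Y s := by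
  ext x; exact (fderiv ℝ s x).map_add _ _

theorem dirDeriv_smul_left (c : ℝ) (X : VecField V) (s : Sec V F) :
    dirDeriv (c • X) s = c • dirDeriv X s := by
  ext x; exact (fderiv ℝ s x).map_smul _ _

theorem dirDeriv_fun_smul_left (f : SmoothFun V) (X : VecField V) (s : Sec V F) :
    dirDeriv (f • X) s = f • dirDeriv X s := by
  ext x; exact (fderiv ℝ s x).map_smul _ _

theorem dirDeriv_zero_left (s : Sec V F) : dirDeriv (0 : VecField V) s = 0 := by
  ext x; exact (fderiv ℝ s x).map_zero

theorem dirDeriv_add_right (X : VecField V) (s t : Sec V F) :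
    dirDeriv X (s + t) = dirDeriv X s + dirDeriv X t := by
  ext x
  have : fderiv ℝ (⇑(s + t)) x = fderiv ℝ s x + fderiv ℝ t x :=
    fderiv_add (s.differentiableAt x) (t.differentiableAt x)
  simp [dirDeriv_apply, this]

theorem dirDeriv_smul_right (c : ℝ) (X : VecField V) (s : Sec V F) :
    dirDeriv X (c • s) = c • dirDeriv X s := by
  ext x
  have : fderiv ℝ (⇑(c • s)) x = c • fderiv ℝ s x := fderiv_const_smul (s.differentiableAt x) c
  simp [dirDeriv_apply, this]

theorem dirDeriv_fun_smul_right (X : VecField V) (f : SmoothFun V) (s : Sec V F) :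
    dirDeriv X (f • s) = f • dirDeriv X s + dirDeriv X f • s := by
  ext x
  have : fderiv ℝ (⇑(f • s)) x = _ := fderiv_smul (f.differentiableAt x) (s.differentiableAt x)
  rw [dirDeriv_apply, this]
  rfl

theorem hasFDerivAt_mapSec (A : F →L[ℝ] G) (s : Sec V F) (x : V) :
    HasFDerivAt (mapSec A s) (A.comp (fderiv ℝ s x)) x :=
  A.hasFDerivAt.comp x (s.differentiableAt x).hasFDerivAt

theorem dirDeriv_mapSec (X : VecField V) (A : F →L[ℝ] G) (s : Sec V F) :
    dirDeriv X (mapSec A s) = mapSec A (dirDeriv X s) := by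
  ext x
  have : fderiv ℝ (⇑(mapSec A s)) x = A.comp (fderiv ℝ s x) := (hasFDerivAt_mapSec A s x).fderiv
  simp [dirDeriv_apply, this]

theorem fderiv_dirDeriv (X : VecField V) (s : Sec V F) (x v : V) :
    fderiv ℝ (dirDeriv X s) x v =
      fderiv ℝ (fderiv ℝ s) x v (X x) + fderiv ℝ s x (fderiv ℝ X x v) := by
  have h1 : DifferentiableAt ℝ (fderiv ℝ s) x :=
    (s.contDiff.fderiv_right (m := ∞) (by simp)).differentiable (by simp) x
  have h2 := h1.hasFDerivAt.clm_apply (X.differentiableAt x).hasFDerivAt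
  have h3 : fderiv ℝ (dirDeriv X s) x = _ := h2.fderiv
  rw [h3]
  simp [add_comm]

theorem fderiv_fderiv_symm (s : Sec V F) (x v w : V) :
    fderiv ℝ (fderiv ℝ s) x v w = fderiv ℝ (fderiv ℝ s) x w v :=
  (s.contDiff.contDiffAt.isSymmSndFDerivAt
    (by rw [minSmoothness_of_isRCLikeNormedField]; exact ENat.LEInfty.out)) v w

theorem ev_zero {n : ℕ} : ev (0 : Alt V n) = 0 := by simpa using ev_smul 0 (0 : Alt V n)

theorem ev_apply_of_curryLeft {n : ℕ} (φ : Alt V (n + 1)) (v : V) (l : List V) :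
    ev φ (v :: l) = ev (φ.curryLeft v) l := congrFun (contr_ev φ v) l

theorem ev_zero_form (φ : Alt V 0) (v : Fin 0 → V) : ev φ [] = φ v := by
  rw [← ev_ofFn φ v, List.ofFn_zero]

theorem ev_one_form (φ : Alt V 1) (v : V) : ev φ [v] = φ fun _ => v := by
  rw [← ev_ofFn φ fun _ => v]; simp

/-- A list of length one has the wrong length for forms of higher degree, so one formula covers the
extension of the anchor by zero. -/
theorem anchorDeg_apply (a : ℕ) (s : Sec V (Alt V (a + 1))) (x : V) :
    anchorDeg a s x = ev (s x) [x] := by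
  cases a with
  | zero => rw [ev_one_form]; rfl
  | succ a => rw [supp_ev _ _ (by simp)]; rfl

theorem anchorDeg_add (a : ℕ) (s t : Sec V (Alt V (a + 1))) :
    anchorDeg a (s + t) = anchorDeg a s + anchorDeg a t := by
  ext x; simp [anchorDeg_apply, ev_add]

theorem anchorDeg_smul (a : ℕ) (c : ℝ) (s : Sec V (Alt V (a + 1))) :
    anchorDeg a (c • s) = c • anchorDeg a s := by
  ext x; simp [anchorDeg_apply, ev_smul]

theorem anchorDeg_fun_smul (a : ℕ) (f : SmoothFun V) (s : Sec V (Alt V (a + 1))) :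
    anchorDeg a (f • s) = f • anchorDeg a s := by
  ext x; simp [anchorDeg_apply, ev_smul]

theorem fderiv_koszul (j : ℕ) (s : Sec V (Alt V (j + 1))) (x v : V) :
    fderiv ℝ (koszul j s) x v = (fderiv ℝ s x v).curryLeft x + (s x).curryLeft v := by
  let A : Alt V (j + 1) →L[ℝ] V →L[ℝ] Alt V j :=
    (ContinuousAlternatingMap.curryLeftLI (𝕜 := ℝ) (E := V) (F := V) (n := j)).toContinuousLinearMap
  have h1 := A.hasFDerivAt_of_bilinear (s.differentiableAt x).hasFDerivAt (hasFDerivAt_id x)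
  have h3 : fderiv ℝ (koszul j s) x = _ := h1.fderiv
  rw [h3]
  exact add_comm _ _

theorem anchorMap_eq_koszul (s : Sec V (Alt V 1)) (x : V) (v : Fin 0 → V) :
    anchorMap s x = koszul 0 s x v := by
  rw [koszul_apply]
  change s x (fun _ => x) = _
  congr 1
  ext i
  rw [Subsingleton.elim i 0]
  rfl

/-- Product rule for x ↦ t(x)(x); for b > 0 every term is zero. -/
theorem fderiv_anchorDeg (b : ℕ) (t : Sec V (Alt V (b + 1))) (x v : V) :
    fderiv ℝ (anchorDeg b t) x v = ev (fderiv ℝ t x v) [x] + ev (t x) [v] := by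
  cases b with
  | succ b =>
    rw [supp_ev _ _ (by simp), supp_ev _ _ (by simp)]
    have : (⇑(anchorDeg (b + 1) t) : V → V) = fun _ => 0 := rfl
    rw [this]
    simp
  | zero =>
    let B := ContinuousAlternatingMap.apply ℝ V V (ι := Fin 0) (fun i => i.elim0)
    have h : (⇑(anchorDeg 0 t) : V → V) = fun y => B (koszul 0 t y) :=
      funext fun y => anchorMap_eq_koszul t y _
    have h2 : fderiv ℝ (fun y => B (koszul 0 t y)) x = B.comp (fderiv ℝ (koszul 0 t) x) :=
      (B.hasFDerivAt.comp x ((koszul 0 t).differentiableAt x).hasFDerivAt).fderiv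
    rw [h, h2, ContinuousLinearMap.comp_apply, fderiv_koszul, ev_apply_of_curryLeft,
      ev_apply_of_curryLeft, ev_zero_form _ fun i => i.elim0, ev_zero_form _ fun i => i.elim0]
    rfl

variable [FiniteDimensional ℝ V]

theorem ev_insertSec (a b : ℕ) (s : Sec V (Alt V (a + 1))) (t : Sec V (Alt V (b + 1))) (x : V) :
    ev (insertSec a b s t x) = ins (ev (s x)) (ev (t x)) := ev_insertion a b _ _

theorem fderiv_insertSec (a b : ℕ) (s : Sec V (Alt V (a + 1))) (t : Sec V (Alt V (b + 1)))
    (x v : V) : fderiv ℝ (insertSec a b s t) x v =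
      insertion a b (fderiv ℝ s x v) (t x) + insertion a b (s x) (fderiv ℝ t x v) := by
  let A : Alt V (a + 1) →L[ℝ] Alt V (b + 1) →L[ℝ] Alt V (a + b + 1) :=
    (insertionBilin a b).toContinuousBilinearMap
  have h := (A.hasFDerivAt_of_bilinear (s.differentiableAt x).hasFDerivAt
    (t.differentiableAt x).hasFDerivAt)
  have h3 : fderiv ℝ (insertSec a b s t) x = _ := h.fderiv
  rw [h3]
  exact add_comm _ _

end SectionCalculus

/-! ### Sections of graded bundles -/

section Graded

variable {V : Type*} [NormedAddCommGroup V] [NormedSpace ℝ V]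

/-- The value at a point of a section of the graded bundle, as a function on lists. -/
def evGr (g : GrSec V (AltFib V)) (x : V) : List V → V
  | [] => 0
  | v :: l => g l.length x fun i => (v :: l).get i

@[simp] theorem evGr_nil (g : GrSec V (AltFib V)) (x : V) : evGr g x [] = 0 := rfl

theorem evGr_add (g h : GrSec V (AltFib V)) (x : V) : evGr (g + h) x = evGr g x + evGr h x := by
  funext l
  cases l with
  | nil => simp
  | cons v l => rfl

theorem evGr_smul (c : ℝ) (g : GrSec V (AltFib V)) (x : V) : evGr (c • g) x = c • evGr g x := by
  funext l
  cases l with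
  | nil => simp
  | cons v l => rfl

theorem evGr_sub (g h : GrSec V (AltFib V)) (x : V) : evGr (g - h) x = evGr g x - evGr h x := by
  rw [sub_eq_add_neg, ← neg_one_smul ℝ h, evGr_add, evGr_smul]
  simp [sub_eq_add_neg]

theorem evGr_zero (x : V) : evGr (0 : GrSec V (AltFib V)) x = 0 := by
  simpa using evGr_smul 0 (0 : GrSec V (AltFib V)) x

theorem evGr_eq_ev (g : GrSec V (AltFib V)) (x : V) {j : ℕ} {l : List V} (h : l.length = j + 1) :
    evGr g x l = ev (g j x) l := by
  cases l with
  | nil => simp at h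
  | cons v l =>
    obtain rfl : l.length = j := by simpa using h
    rw [evGr, ev, dif_pos (by simp)]
    rfl

theorem evGr_homog (a : ℕ) (s : Sec V (Alt V (a + 1))) (x : V) :
    evGr (homog (F := AltFib V) a s) x = ev (s x) := by
  funext l
  cases l with
  | nil => rw [supp_ev _ _ (by simp)]; rfl
  | cons v l =>
    rw [evGr_eq_ev (j := l.length) _ _ (by simp)]
    by_cases h : l.length = a
    · subst h
      rw [DirectSum.of_eq_same]
    · rw [DirectSum.of_eq_of_ne _ _ _ h, supp_ev (s x) _ (by simpa using h)]
      exact congrFun ev_zero _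

/-- The length of a list selects the component. Nonempty lists suffice because all components have
positive form degree. -/
theorem evGr_injective {g h : GrSec V (AltFib V)}
    (hgh : ∀ x v l, evGr g x (v :: l) = evGr h x (v :: l)) : g = h := by
  apply DFinsupp.ext
  intro j
  apply Sec.ext
  intro x
  apply ev_injective
  funext l
  by_cases hl : l.length = j + 1
  · rw [← evGr_eq_ev g x hl, ← evGr_eq_ev h x hl]
    cases l with
    | nil => simp at hl
    | cons v l => exact hgh x v l
  · rw [supp_ev _ _ hl, supp_ev _ _ hl]

variable {F : ℕ → Type*} [∀ i, NormedAddCommGroup (F i)] [∀ i, NormedSpace ℝ (F i)]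

/-- Linear maps on sections of a graded bundle, given by their values on homogeneous sections. -/
def grLinear {M : Type*} [AddCommGroup M] [Module ℝ M] (B : ∀ a, Sec V (F a) →ₗ[ℝ] M) :
    GrSec V F →ₗ[ℝ] M :=
  DirectSum.toModule ℝ ℕ M B

theorem grLinear_homog {M : Type*} [AddCommGroup M] [Module ℝ M] (B : ∀ a, Sec V (F a) →ₗ[ℝ] M)
    (a : ℕ) (s : Sec V (F a)) : grLinear B (homog a s) = B a s := by
  rw [grLinear, homog, ← DirectSum.lof_eq_of ℝ, DirectSum.toModule_lof]

/-- Bilinear maps on sections of a graded bundle, given by their values on homogeneous sections. -/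
def grBilinear {M : Type*} [AddCommGroup M] [Module ℝ M]
    (B : ∀ a b, Sec V (F a) →ₗ[ℝ] Sec V (F b) →ₗ[ℝ] M) : GrSec V F →ₗ[ℝ] GrSec V F →ₗ[ℝ] M :=
  grLinear fun a => (grLinear fun b => (B a b).flip).flip

theorem grBilinear_homog {M : Type*} [AddCommGroup M] [Module ℝ M]
    (B : ∀ a b, Sec V (F a) →ₗ[ℝ] Sec V (F b) →ₗ[ℝ] M) (a b : ℕ) (s : Sec V (F a))
    (t : Sec V (F b)) : grBilinear B (homog a s) (homog b t) = B a b s t := by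
  rw [grBilinear, grLinear_homog, LinearMap.flip_apply, grLinear_homog, LinearMap.flip_apply]

theorem homog_add (a : ℕ) (s t : Sec V (F a)) : homog (F := F) a (s + t) = homog a s + homog a t :=
  map_add _ _ _

theorem homog_sub (a : ℕ) (s t : Sec V (F a)) : homog (F := F) a (s - t) = homog a s - homog a t :=
  map_sub _ _ _

theorem homog_smul (a : ℕ) (c : ℝ) (s : Sec V (F a)) : homog (F := F) a (c • s) = c • homog a s :=
  (DirectSum.lof ℝ ℕ (fun i => Sec V (F i)) a).map_smul c s

theorem homog_fun_smul (a : ℕ) (f : SmoothFun V) (s : Sec V (F a)) :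
    homog (F := F) a (f • s) = f • homog a s :=
  (DirectSum.lof (SmoothFun V) ℕ (fun i => Sec V (F i)) a).map_smul f s

end Graded

/-! ### The pre-Lie product on form-valued sections -/

section PreLie

variable {V : Type*} [NormedAddCommGroup V] [NormedSpace ℝ V] [FiniteDimensional ℝ V]

/-- The product whose graded commutator is the Nijenhuis–Richardson bracket. -/
def circ {a b : ℕ} (s : Sec V (Alt V (a + 1))) (t : Sec V (Alt V (b + 1))) : GrSec V (AltFib V) :=
  homog (F := AltFib V) (a + b) (insertSec a b s t) +
    homog (F := AltFib V) b (dirDeriv (anchorDeg a s) t)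

theorem insertSec_add_left (a b : ℕ) (s s' : Sec V (Alt V (a + 1))) (t : Sec V (Alt V (b + 1))) :
    insertSec a b (s + s') t = insertSec a b s t + insertSec a b s' t :=
  Sec.ext fun x => LinearMap.congr_fun ((insertionBilin a b).map_add (s x) (s' x)) (t x)

theorem insertSec_add_right (a b : ℕ) (s : Sec V (Alt V (a + 1))) (t t' : Sec V (Alt V (b + 1))) :
    insertSec a b s (t + t') = insertSec a b s t + insertSec a b s t' :=
  Sec.ext fun x => (insertionBilin a b (s x)).map_add (t x) (t' x)

theorem insertSec_smul_left (a b : ℕ) (c : ℝ) (s : Sec V (Alt V (a + 1)))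
    (t : Sec V (Alt V (b + 1))) : insertSec a b (c • s) t = c • insertSec a b s t :=
  Sec.ext fun x => LinearMap.congr_fun ((insertionBilin a b).map_smul c (s x)) (t x)

theorem insertSec_smul_right (a b : ℕ) (c : ℝ) (s : Sec V (Alt V (a + 1)))
    (t : Sec V (Alt V (b + 1))) : insertSec a b s (c • t) = c • insertSec a b s t :=
  Sec.ext fun x => (insertionBilin a b (s x)).map_smul c (t x)

theorem insertSec_fun_smul_left (a b : ℕ) (f : SmoothFun V) (s : Sec V (Alt V (a + 1)))
    (t : Sec V (Alt V (b + 1))) : insertSec a b (f • s) t = f • insertSec a b s t :=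
  Sec.ext fun x => LinearMap.congr_fun ((insertionBilin a b).map_smul (f x) (s x)) (t x)

theorem insertSec_fun_smul_right (a b : ℕ) (f : SmoothFun V) (s : Sec V (Alt V (a + 1)))
    (t : Sec V (Alt V (b + 1))) : insertSec a b s (f • t) = f • insertSec a b s t :=
  Sec.ext fun x => (insertionBilin a b (s x)).map_smul (f x) (t x)

/-- `circ` as a bilinear map. -/
def circBilin (a b : ℕ) :
    Sec V (AltFib V a) →ₗ[ℝ] Sec V (AltFib V b) →ₗ[ℝ] GrSec V (AltFib V) :=
  LinearMap.mk₂ ℝ circ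
    (fun s s' t => by
      simp only [circ, insertSec_add_left, anchorDeg_add, dirDeriv_add_left, homog_add]; abel)
    (fun c s t => by
      simp only [circ, insertSec_smul_left, anchorDeg_smul, dirDeriv_smul_left, homog_smul,
        smul_add])
    (fun s t t' => by
      simp only [circ, insertSec_add_right, dirDeriv_add_right, homog_add]; abel)
    (fun c s t => by
      simp only [circ, insertSec_smul_right, dirDeriv_smul_right, homog_smul, smul_add])

/-- `circ`, extended to the graded bundle. -/
def circGr : GrSec V (AltFib V) →ₗ[ℝ] GrSec V (AltFib V) →ₗ[ℝ] GrSec V (AltFib V) :=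
  grBilinear circBilin

theorem circGr_homog (a b : ℕ) (s : Sec V (AltFib V a)) (t : Sec V (AltFib V b)) :
    circGr (homog a s) (homog b t) = circ s t := grBilinear_homog _ _ _ _ _

theorem evGr_circ {a b : ℕ} (s : Sec V (Alt V (a + 1))) (t : Sec V (Alt V (b + 1))) (x : V) :
    evGr (circ s t) x = ins (ev (s x)) (ev (t x)) + ev (fderiv ℝ t x (anchorDeg a s x)) := by
  rw [circ, evGr_add, evGr_homog, evGr_homog, ev_insertSec]
  rfl

/-- Forms of positive degree vanish on the empty list, so only the term feeding x to s survives. -/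
theorem anchorDeg_insertSec (a b : ℕ) (s : Sec V (Alt V (a + 1))) (t : Sec V (Alt V (b + 1)))
    (x : V) : anchorDeg (a + b) (insertSec a b s t) x = ev (t x) [anchorDeg a s x] := by
  rw [anchorDeg_apply, ev_insertSec, ins_cons, ins_nil, ins_nil, contr_apply, contr_apply, bar_apply,
    supp_ev (s x) [] (by simp), smul_zero, ← anchorDeg_apply]
  have := ((isAlt_ev (t x)).linear [x] []).map_zero
  simp only [List.singleton_append] at this
  rw [this, add_zero]

/-- The product rule gives D(ρ(t))(ρ(s)) = ρ(ρ(s)(t)) + t(ρ(s)), and the last term is ρ(i_s t).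
Hence the first-order terms in which u is differentiated along these fields cancel, as do those with
i of ρ(s)(t). -/
theorem evGr_circ_assoc {a b c : ℕ} (s : Sec V (AltFib V a)) (t : Sec V (AltFib V b))
    (u : Sec V (AltFib V c)) (x : V) :
    evGr (circGr (homog a s) (circGr (homog b t) (homog c u)) -
      circGr (circGr (homog a s) (homog b t)) (homog c u)) x =
    assoc (ev (s x)) (ev (t x)) (ev (u x)) +
      ins (ev (t x)) (ev (fderiv ℝ u x (anchorDeg a s x))) +
      ins (ev (s x)) (ev (fderiv ℝ u x (anchorDeg b t x))) +
      ev (fderiv ℝ (fderiv ℝ u) x (anchorDeg a s x) (anchorDeg b t x)) := by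
  have h1 : circGr (homog a s) (circGr (homog b t) (homog c u)) =
      circ s (insertSec b c t u) + circ s (dirDeriv (anchorDeg b t) u) := by
    rw [circGr_homog b c, circ, map_add, circGr_homog, circGr_homog]
  have h2 : circGr (circGr (homog a s) (homog b t)) (homog c u) =
      circ (insertSec a b s t) u + circ (dirDeriv (anchorDeg a s) t) u := by
    rw [circGr_homog a b, circ, map_add, LinearMap.add_apply, circGr_homog, circGr_homog]
  rw [evGr_sub, h1, h2, evGr_add, evGr_add, evGr_circ, evGr_circ, evGr_circ, evGr_circ,
    ev_insertSec, ev_insertSec, fderiv_insertSec, ev_add, ev_insertion, ev_insertion,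
    fderiv_dirDeriv, ev_add, dirDeriv_apply, dirDeriv_apply, anchorDeg_insertSec,
    anchorDeg_apply b (dirDeriv _ _), dirDeriv_apply, fderiv_anchorDeg, map_add, ev_add, assoc]
  abel

/-- In `evGr_circ_assoc` the two middle terms are exchanged by s ↔ t, the Hessian term is symmetric,
and the first term is governed by `assoc_symm`. -/
theorem circGr_preLie {a b c : ℕ} (s : Sec V (AltFib V a)) (t : Sec V (AltFib V b))
    (u : Sec V (AltFib V c)) :
    circGr (homog a s) (circGr (homog b t) (homog c u)) -
      circGr (circGr (homog a s) (homog b t)) (homog c u) =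
    (-1 : ℝ) ^ (a * b) • (circGr (homog b t) (circGr (homog a s) (homog c u)) -
      circGr (circGr (homog b t) (homog a s)) (homog c u)) := by
  -- A nonzero anchor of s forces a = 0, and then the sign is 1; likewise for t and b below.
  have key : ∀ x, ev (fderiv ℝ u x (anchorDeg a s x)) =
      (-1 : ℝ) ^ (a * b) • ev (fderiv ℝ u x (anchorDeg a s x)) := by
    intro x
    cases a with
    | zero => simp
    | succ a => simp [anchorDeg, ev_zero]
  have key' : ∀ x, ev (fderiv ℝ u x (anchorDeg b t x)) =
      (-1 : ℝ) ^ (a * b) • ev (fderiv ℝ u x (anchorDeg b t x)) := by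
    intro x
    cases b with
    | zero => simp
    | succ b => simp [anchorDeg, ev_zero]
  have key2 : ∀ x, ev (fderiv ℝ (fderiv ℝ u) x (anchorDeg a s x) (anchorDeg b t x)) =
      (-1 : ℝ) ^ (a * b) • ev (fderiv ℝ (fderiv ℝ u) x (anchorDeg b t x) (anchorDeg a s x)) := by
    intro x
    rw [fderiv_fderiv_symm u]
    cases a with
    | zero => simp
    | succ a => simp [anchorDeg, ev_zero]
  refine evGr_injective fun x v l => congrFun ?_ _
  rw [evGr_smul, evGr_circ_assoc, evGr_circ_assoc,
    assoc_symm (par_ev (s x)) (par_ev (t x)) (isAlt_ev _).linear (isAlt_ev _).linear (isAlt_ev _),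
    smul_add, smul_add, smul_add, ← ins_smul_right, ← ins_smul_right, ← key, ← key', ← key2]
  abel

end PreLie

/-! ### The Koszul differential as a derivation -/

section Differential

variable {V : Type*} [NormedAddCommGroup V] [NormedSpace ℝ V]

/-- The Koszul differential on the graded bundle, zero on the component of degree `0`. -/
def koszulGr : GrSec V (AltFib V) →ₗ[ℝ] GrSec V (AltFib V) :=
  grLinear fun a => match a with
    | 0 => 0
    | j + 1 =>
      { toFun := fun s => homog (F := AltFib V) j (koszul (j + 1) s)
        map_add' := fun s t => by rw [map_add, homog_add]
        map_smul' := fun c s => by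
          rw [RingHom.id_apply, ← homog_smul]
          rfl }

theorem koszulGr_homog_zero (s : Sec V (AltFib V 0)) :
    koszulGr (homog (F := AltFib V) 0 s) = 0 := grLinear_homog _ _ _

theorem koszulGr_homog_succ (j : ℕ) (s : Sec V (AltFib V (j + 1))) :
    koszulGr (homog (F := AltFib V) (j + 1) s) = homog (F := AltFib V) j (koszul (j + 1) s) :=
  grLinear_homog _ _ _

theorem ev_koszul (j : ℕ) (s : Sec V (Alt V (j + 1))) (x : V) :
    ev (koszul j s x) = contr x (ev (s x)) := (contr_ev (s x) x).symm

theorem evGr_koszulGr_homog (a : ℕ) (s : Sec V (AltFib V a)) (x v : V) (l : List V) :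
    evGr (koszulGr (homog (F := AltFib V) a s)) x (v :: l) = ev (s x) (x :: v :: l) := by
  cases a with
  | zero => rw [koszulGr_homog_zero, evGr_zero, supp_ev (s x) _ (by simp)]; rfl
  | succ j => rw [koszulGr_homog_succ, evGr_homog, ev_koszul]; rfl

theorem ev_repeat {n : ℕ} (φ : Alt V n) (x : V) (l : List V) : ev φ (x :: x :: l) = 0 := by
  have h := (isAlt_ev φ).swap [] l x x
  simp only [List.nil_append] at h
  have h2 : (2 : ℝ) • ev φ (x :: x :: l) = 0 := by rw [two_smul]; nth_rewrite 1 [h]; simp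
  exact (smul_eq_zero.mp h2).resolve_left two_ne_zero

theorem koszul_koszul (j : ℕ) (s : Sec V (Alt V (j + 2))) : koszul j (koszul (j + 1) s) = 0 := by
  ext1 x
  apply ev_injective
  funext l
  rw [ev_koszul, ev_koszul, Sec.zero_apply, ev_zero]
  exact ev_repeat _ _ _

theorem koszulGr_koszulGr (a : ℕ) (s : Sec V (AltFib V a)) :
    koszulGr (koszulGr (homog (F := AltFib V) a s)) = 0 := by
  rcases a with _ | _ | a
  · rw [koszulGr_homog_zero, map_zero]
  · rw [koszulGr_homog_succ, koszulGr_homog_zero]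
  · rw [koszulGr_homog_succ, koszulGr_homog_succ, koszul_koszul]
    exact map_zero _

theorem anchorDeg_koszul (a : ℕ) (s : Sec V (Alt V (a + 2))) :
    anchorDeg a (koszul (a + 1) s) = 0 := by
  ext x
  rw [anchorDeg_apply, ev_koszul]
  exact ev_repeat _ _ _

variable [FiniteDimensional ℝ V]

/-- For a = 0 the contraction of s is the 0-form ρ(s), which `koszulGr` discards; the subtracted
term is its insertion into t. For a > 0 that term is zero. -/
theorem evGr_circGr_koszulGr_left {a b : ℕ} (s : Sec V (AltFib V a)) (t : Sec V (AltFib V b))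
    (x v : V) (l : List V) :
    evGr (circGr (koszulGr (homog a s)) (homog b t)) x (v :: l) =
      ins (contr x (ev (s x))) (ev (t x)) (v :: l) - ev (t x) (anchorDeg a s x :: v :: l) := by
  cases a with
  | zero =>
    rw [koszulGr_homog_zero, map_zero, LinearMap.zero_apply, evGr_zero, anchorDeg_apply,
      ins_of_contr_left (fun w => ?_) (isAlt_ev (t x))]
    · simp
    · funext l
      exact supp_ev (s x) (x :: w :: l) (by simp)
  | succ a =>
    have h0 := ((isAlt_ev (t x)).linear [] (v :: l)).map_zero
    simp only [List.nil_append] at h0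
    rw [koszulGr_homog_succ, circGr_homog, evGr_circ, anchorDeg_koszul, ev_koszul]
    simp [anchorDeg, ev_zero, h0]

/-- The last term comes from differentiating the Euler field along ρ(s). In `koszulGr_circGr` it
cancels the correction in `evGr_circGr_koszulGr_left`. -/
theorem evGr_circGr_koszulGr_right {a b : ℕ} (s : Sec V (AltFib V a)) (t : Sec V (AltFib V b))
    (x v : V) (l : List V) :
    evGr (circGr (homog a s) (koszulGr (homog b t))) x (v :: l) =
      ins (ev (s x)) (contr x (ev (t x))) (v :: l) +
        ev (fderiv ℝ t x (anchorDeg a s x)) (x :: v :: l) + ev (t x) (anchorDeg a s x :: v :: l) := by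
  cases b with
  | zero =>
    rw [koszulGr_homog_zero, map_zero, evGr_zero, ins_of_contr_right _ (fun w => ?_),
      supp_ev _ _ (by simp), supp_ev _ _ (by simp)]
    · simp
    · funext l
      exact supp_ev (t x) (x :: w :: l) (by simp)
  | succ b =>
    rw [koszulGr_homog_succ, circGr_homog, evGr_circ, ev_koszul, fderiv_koszul, ev_add, ← contr_ev,
      ← contr_ev]
    simp [add_assoc]

/-- The Koszul differential is a derivation of `circ`. -/
theorem koszulGr_circGr {a b : ℕ} (s : Sec V (AltFib V a)) (t : Sec V (AltFib V b)) :
    koszulGr (circGr (homog a s) (homog b t)) =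
      circGr (koszulGr (homog a s)) (homog b t) +
        (-1 : ℝ) ^ a • circGr (homog a s) (koszulGr (homog b t)) := by
  refine evGr_injective fun x v l => ?_
  rw [evGr_add, evGr_smul, Pi.add_apply, Pi.smul_apply, evGr_circGr_koszulGr_left,
    evGr_circGr_koszulGr_right, circGr_homog, circ, map_add, evGr_add, Pi.add_apply,
    evGr_koszulGr_homog, evGr_koszulGr_homog, ev_insertSec, ins_cons, par_ev (s x),
    ins_smul_left _ _ ((isAlt_ev (t x)).linear.contraction x), Pi.smul_apply, dirDeriv_apply]
  cases a with
  | zero =>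
    simp only [pow_zero, one_smul]
    abel
  | succ a =>
    have h0 := ((isAlt_ev (t x)).linear [] (v :: l)).map_zero
    simp only [List.nil_append] at h0
    simp [anchorDeg, ev_zero, h0]

end Differential

/-! ### Stability of K under the operations, and a retraction onto it -/

section Subbundle

set_option linter.unusedSectionVars false

variable {V : Type*} [NormedAddCommGroup V] [NormedSpace ℝ V] (W : Submodule ℝ V)

theorem mem_K_iff {j : ℕ} {φ : Alt V (j + 1)} :
    φ ∈ K W j ↔ ∀ (v : Fin (j + 1) → V) (i : Fin (j + 1)), v i ∈ W → φ v ∈ W := by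
  constructor
  · intro h v i hi
    have h1 : φ (Fin.cons (v i) (i.removeNth v)) ∈ W := h _ hi _
    have h2 := φ.map_insertNth i (v i) (i.removeNth v)
    rw [Fin.insertNth_self_removeNth] at h2
    rw [h2]
    rcases Nat.even_or_odd (i : ℕ) with he | he
    · rw [he.neg_one_pow, one_smul]
      exact h1
    · rw [he.neg_one_pow, neg_smul, one_smul]
      exact W.neg_mem h1
  · exact fun h w hw v => h _ 0 hw

theorem curryLeft_mem_K {j : ℕ} {φ : Alt V (j + 2)} (hφ : φ ∈ K W (j + 1)) (x : V) :
    φ.curryLeft x ∈ K W j :=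
  fun w hw v => (mem_K_iff W).1 hφ (Fin.cons x (Fin.cons w v)) 1 hw

theorem koszul_mem_secK {j : ℕ} {s : Sec V (Alt V (j + 2))} (hs : s ∈ secK W (j + 1)) :
    koszul (j + 1) s ∈ secK W j := fun x => curryLeft_mem_K W (hs x) x

/-- In each term the vector of W is fed either directly to ψ, or to φ, whose value then lies in W
and is an argument of ψ. -/
theorem insertion_mem_K {a b : ℕ} {φ : Alt V (a + 1)} {ψ : Alt V (b + 1)} (hφ : φ ∈ K W a)
    (hψ : ψ ∈ K W b) : insertion a b φ ψ ∈ K W (a + b) := by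
  rw [mem_K_iff]
  intro v i hi
  rw [insertion_apply]
  refine W.smul_mem _ (W.sum_mem fun σ _ => ?_)
  have key : ψ (Fin.cons (φ (v ∘ σ ∘ firstPos a b)) (v ∘ σ ∘ lastPos a b)) ∈ W := by
    rcases exists_pos (σ.symm i) with ⟨k, hk⟩ | ⟨k, hk⟩
    · refine (mem_K_iff W).1 hψ _ 0 ((mem_K_iff W).1 hφ _ k ?_)
      simpa [← hk] using hi
    · refine (mem_K_iff W).1 hψ _ k.succ ?_
      simpa [← hk] using hi
  rcases Int.units_eq_one_or (Equiv.Perm.sign σ) with h | h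
  · rw [h, one_smul]
    exact key
  · rw [h, Units.neg_smul, one_smul]
    exact W.neg_mem key

variable [FiniteDimensional ℝ V]

theorem exists_retraction (j : ℕ) :
    ∃ π : Alt V (j + 1) →L[ℝ] KFib W j, ∀ k, π (inclFib W j k) = k := by
  obtain ⟨g, hg⟩ := (K W j).subtype.exists_leftInverse_of_injective (Submodule.ker_subtype _)
  exact ⟨LinearMap.toContinuousLinearMap g, fun k => LinearMap.congr_fun hg k⟩

/-- A linear retraction onto `K_{j+1}`. -/
def retr (j : ℕ) : Alt V (j + 1) →L[ℝ] KFib W j := (exists_retraction W j).choose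

theorem retr_inclFib {j : ℕ} (k : KFib W j) : retr W j (inclFib W j k) = k :=
  (exists_retraction W j).choose_spec k

theorem inclFib_retr {j : ℕ} {φ : Alt V (j + 1)} (hφ : φ ∈ K W j) :
    inclFib W j (retr W j φ) = φ :=
  congrArg (inclFib W j) (retr_inclFib W (⟨φ, hφ⟩ : K W j))

theorem inclK_mem_secK {j : ℕ} (s : Sec V (KFib W j)) : inclK W j s ∈ secK W j :=
  fun x => (show K W j from s x).2

theorem inclK_retr {j : ℕ} {s : Sec V (Alt V (j + 1))} (hs : s ∈ secK W j) :
    inclK W j (mapSec (retr W j) s) = s :=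
  Sec.ext fun x => inclFib_retr W (hs x)

theorem retr_inclK {j : ℕ} (s : Sec V (KFib W j)) : mapSec (retr W j) (inclK W j s) = s :=
  Sec.ext fun x => retr_inclFib W (s x)

theorem inclK_injective (j : ℕ) : Function.Injective (inclK W j) :=
  Function.LeftInverse.injective (retr_inclK W)

/-- The fibre K is constant, so s factors through the linear inclusion, which commutes with
differentiation. -/
theorem dirDeriv_mem_secK {j : ℕ} (X : VecField V) {s : Sec V (Alt V (j + 1))}
    (hs : s ∈ secK W j) : dirDeriv X s ∈ secK W j := by
  rw [← inclK_retr W hs, inclK, dirDeriv_mapSec]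
  exact inclK_mem_secK W _

theorem insertSec_mem_secK {a b : ℕ} {s : Sec V (Alt V (a + 1))} {t : Sec V (Alt V (b + 1))}
    (hs : s ∈ secK W a) (ht : t ∈ secK W b) : insertSec a b s t ∈ secK W (a + b) :=
  fun x => insertion_mem_K W (hs x) (ht x)

theorem exists_homog_eq {a b : ℕ} (h : a = b) {s : Sec V (Alt V (a + 1))} (hs : s ∈ secK W a) :
    ∃ t ∈ secK W b, homog (F := AltFib V) a s = homog (F := AltFib V) b t := by
  subst h
  exact ⟨s, hs, rfl⟩

/-- The anchor term sits in component b rather than a + b; these agree when a = 0, and otherwise the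
term is zero. -/
theorem exists_circ_eq {a b : ℕ} {s : Sec V (Alt V (a + 1))} {t : Sec V (Alt V (b + 1))}
    (hs : s ∈ secK W a) (ht : t ∈ secK W b) :
    ∃ u ∈ secK W (a + b), circ s t = homog (F := AltFib V) (a + b) u := by
  obtain ⟨r, hr, h⟩ : ∃ r ∈ secK W (a + b),
      homog (F := AltFib V) b (dirDeriv (anchorDeg a s) t) = homog (F := AltFib V) (a + b) r := by
    cases a with
    | zero => exact exists_homog_eq W (Nat.zero_add b).symm (dirDeriv_mem_secK W _ ht)
    | succ a =>
      refine ⟨0, Submodule.zero_mem _, ?_⟩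
      rw [anchorDeg, dirDeriv_zero_left, homog, homog, map_zero, map_zero]
  exact ⟨insertSec a b s t + r, Submodule.add_mem _ (insertSec_mem_secK W hs ht) hr, by
    rw [circ, h, homog_add]⟩

end Subbundle

/-! ### The Nijenhuis–Richardson bracket as a graded commutator -/

section NijenhuisRichardson

set_option linter.unusedSectionVars false

variable {V : Type*} [NormedAddCommGroup V] [NormedSpace ℝ V] [FiniteDimensional ℝ V]

/-- The Nijenhuis–Richardson bracket on the graded bundle. -/
def nrGr : GrSec V (AltFib V) →ₗ[ℝ] GrSec V (AltFib V) →ₗ[ℝ] GrSec V (AltFib V) :=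
  grBilinear fun a b => circBilin a b - (-1 : ℝ) ^ (a * b) • (circBilin b a).flip

theorem nrGr_homog (a b : ℕ) (s : Sec V (AltFib V a)) (t : Sec V (AltFib V b)) :
    nrGr (homog a s) (homog b t) = circGr (homog a s) (homog b t) -
      (-1 : ℝ) ^ (a * b) • circGr (homog b t) (homog a s) := by
  rw [nrGr, grBilinear_homog, circGr_homog, circGr_homog]
  rfl

theorem nrGr_eq_nrBracket (a b : ℕ) (s : Sec V (AltFib V a)) (t : Sec V (AltFib V b)) :
    nrGr (homog a s) (homog b t) = nrBracket s t := by
  have h : (-1 : ℝ) ^ (a * b) • homog (F := AltFib V) a (dirDeriv (anchorDeg b t) s) =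
      homog (F := AltFib V) a (dirDeriv (anchorDeg b t) s) := by
    cases b with
    | zero => simp
    | succ b => rw [anchorDeg, dirDeriv_zero_left, homog, map_zero, smul_zero]
  rw [nrGr_homog, circGr_homog, circGr_homog, circ, circ, nrBracket, smul_add, h]
  abel

theorem exists_circGr_eq (a b : ℕ) (s : Sec V (AltFib V a)) (t : Sec V (AltFib V b)) :
    ∃ u : Sec V (AltFib V (a + b)),
      circGr (homog a s) (homog b t) = homog (F := AltFib V) (a + b) u := by
  -- For W = ⊤ membership in K is no condition.
  obtain ⟨u, -, hu⟩ := exists_circ_eq (⊤ : Submodule ℝ V) (s := s) (t := t)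
    (fun _ _ _ _ => trivial) (fun _ _ _ _ => trivial)
  exact ⟨u, by rw [circGr_homog, hu]⟩

theorem exists_nrBracket_eq (W : Submodule ℝ V) {a b : ℕ} {s : Sec V (Alt V (a + 1))}
    {t : Sec V (Alt V (b + 1))} (hs : s ∈ secK W a) (ht : t ∈ secK W b) :
    ∃ u ∈ secK W (a + b), nrBracket s t = homog (F := AltFib V) (a + b) u := by
  obtain ⟨u, hu, h⟩ := exists_circ_eq W hs ht
  obtain ⟨u', hu', h'⟩ := exists_circ_eq W ht hs
  obtain ⟨u'', hu'', h''⟩ := exists_homog_eq W (Nat.add_comm b a) hu'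
  refine ⟨u - (algebraMap ℝ ℝ ((-1 : ℝ) ^ (a * b))) • u'', ?_, ?_⟩
  · exact Submodule.sub_mem _ hu fun x => Submodule.smul_mem _ _ (hu'' x)
  · rw [← nrGr_eq_nrBracket, nrGr_homog, circGr_homog, circGr_homog, h, h', h'', homog_sub,
      ← homog_smul]
    rfl

theorem nrGr_homog_skew (a b : ℕ) (s : Sec V (AltFib V a)) (t : Sec V (AltFib V b)) :
    nrGr (homog b t) (homog a s) = -(-1 : ℝ) ^ (a * b) • nrGr (homog a s) (homog b t) := by
  rw [nrGr_homog, nrGr_homog, smul_sub, smul_smul, neg_mul, ← pow_add, (Even.add_self _).neg_one_pow,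
    mul_comm b a]
  module

theorem nrGr_circGr_left (a b c : ℕ) (s : Sec V (AltFib V a)) (t : Sec V (AltFib V b))
    (u : Sec V (AltFib V c)) : nrGr (circGr (homog a s) (homog b t)) (homog c u) =
      circGr (circGr (homog a s) (homog b t)) (homog c u) -
        (-1 : ℝ) ^ ((a + b) * c) • circGr (homog c u) (circGr (homog a s) (homog b t)) := by
  obtain ⟨r, hr⟩ := exists_circGr_eq a b s t
  rw [hr, nrGr_homog]

theorem nrGr_nrGr_homog (a b c : ℕ) (s : Sec V (AltFib V a)) (t : Sec V (AltFib V b))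
    (u : Sec V (AltFib V c)) : nrGr (nrGr (homog a s) (homog b t)) (homog c u) =
      circGr (circGr (homog a s) (homog b t)) (homog c u) -
        (-1 : ℝ) ^ ((a + b) * c) • circGr (homog c u) (circGr (homog a s) (homog b t)) -
      (-1 : ℝ) ^ (a * b) • (circGr (circGr (homog b t) (homog a s)) (homog c u) -
        (-1 : ℝ) ^ ((a + b) * c) • circGr (homog c u) (circGr (homog b t) (homog a s))) := by
  rw [nrGr_homog a b, map_sub, map_smul, LinearMap.sub_apply, LinearMap.smul_apply,
    nrGr_circGr_left, nrGr_circGr_left, Nat.add_comm b a]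

/-- Graded commutators of a graded pre-Lie product satisfy the graded Jacobi identity. -/
theorem jacobi_of_preLie {M : Type*} [AddCommGroup M] [Module ℝ M] {A B E : ℝ}
    (hA : A = 1 ∨ A = -1) (hB : B = 1 ∨ B = -1) (hE : E = 1 ∨ E = -1)
    {x1 x2 x3 x4 x5 x6 y1 y2 y3 y4 y5 y6 : M} (h01 : x1 - y5 = A • (x3 - y6))
    (h02 : x2 - y3 = B • (x5 - y4)) (h12 : x4 - y1 = E • (x6 - y2)) :
    y5 - (B * E) • x5 - A • (y6 - (B * E) • x6) -
      E • (y3 - (A * E) • x3 - B • (y4 - (A * E) • x4)) +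
      (A * B) • (y1 - (A * B) • x1 - E • (y2 - (A * B) • x2)) = 0 := by
  -- For each choice of the signs, the Jacobi sum is a combination of the three pre-Lie identities
  -- with coefficients ±1.
  rcases hA with rfl | rfl <;> rcases hB with rfl | rfl <;> rcases hE with rfl | rfl <;>
    first
    | linear_combination (norm := module) -h01 + h02 - h12
    | linear_combination (norm := module) -h01 + h02 + h12
    | linear_combination (norm := module) -h01 - h02 - h12
    | linear_combination (norm := module) -h01 - h02 + h12

/-- The graded Jacobi identity for the Nijenhuis–Richardson bracket. -/
theorem nrGr_jacobi (a b c : ℕ) (s : Sec V (AltFib V a)) (t : Sec V (AltFib V b))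
    (u : Sec V (AltFib V c)) :
    nrGr (nrGr (homog a s) (homog b t)) (homog c u) -
      (-1 : ℝ) ^ (b * c) • nrGr (nrGr (homog a s) (homog c u)) (homog b t) +
      (-1 : ℝ) ^ (a * b + a * c) • nrGr (nrGr (homog b t) (homog c u)) (homog a s) = 0 := by
  have h12 := circGr_preLie t u s
  have h := jacobi_of_preLie (neg_one_pow_eq_or ℝ (a * b)) (neg_one_pow_eq_or ℝ (a * c))
    (neg_one_pow_eq_or ℝ (b * c)) (circGr_preLie s t u) (circGr_preLie s u t) h12
  rw [nrGr_nrGr_homog, nrGr_nrGr_homog, nrGr_nrGr_homog]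
  simp only [add_mul, pow_add, mul_comm c b, mul_comm c a, mul_comm b a]
  exact h

/-- The Koszul differential is a derivation of the Nijenhuis–Richardson bracket. -/
theorem koszulGr_nrGr (a b : ℕ) (s : Sec V (AltFib V a)) (t : Sec V (AltFib V b)) :
    koszulGr (nrGr (homog a s) (homog b t)) =
      nrGr (koszulGr (homog a s)) (homog b t) +
        (-1 : ℝ) ^ a • nrGr (homog a s) (koszulGr (homog b t)) := by
  -- The commutator sign is (-1)^((a-1)b); the exponent ab + b has the same parity without a
  -- subtraction, and for a = 0 both sides vanish.
  have h1 : ∀ (a b : ℕ) (s : Sec V (AltFib V a)) (t : Sec V (AltFib V b)),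
      nrGr (koszulGr (homog a s)) (homog b t) = circGr (koszulGr (homog a s)) (homog b t) -
      (-1 : ℝ) ^ (a * b + b) • circGr (homog b t) (koszulGr (homog a s)) := by
    intro a b s t
    cases a with
    | zero => simp [koszulGr_homog_zero]
    | succ a =>
      rw [koszulGr_homog_succ, nrGr_homog, show (a + 1) * b + b = a * b + (b + b) by ring, pow_add,
        (Even.add_self b).neg_one_pow, mul_one]
  have h2 : nrGr (homog a s) (koszulGr (homog b t)) = circGr (homog a s) (koszulGr (homog b t)) -
      (-1 : ℝ) ^ (a * b + a) • circGr (koszulGr (homog b t)) (homog a s) := by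
    cases b with
    | zero => simp [koszulGr_homog_zero]
    | succ b =>
      rw [koszulGr_homog_succ, nrGr_homog, show a * (b + 1) + a = a * b + (a + a) by ring, pow_add,
        (Even.add_self a).neg_one_pow, mul_one]
  rw [h1, h2, nrGr_homog, map_sub, map_smul, koszulGr_circGr, koszulGr_circGr, smul_sub, smul_smul,
    ← pow_add, show a + (a * b + a) = a * b + (a + a) by ring, pow_add _ _ (a + a),
    (Even.add_self a).neg_one_pow, mul_one, pow_add]
  module

theorem fun_smul_comm {F : ℕ → Type*} [∀ i, NormedAddCommGroup (F i)] [∀ i, NormedSpace ℝ (F i)]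
    (c : ℝ) (f : SmoothFun V) (g : GrSec V F) : f • c • g = c • f • g :=
  DFinsupp.ext fun j => Sec.ext fun x => smul_comm (f x) c (g j x)

theorem nrGr_leibniz (x y : GrSec V (AltFib V)) (f : SmoothFun V) :
    nrGr x (f • y) = f • nrGr x y + dirDeriv (anchorMap (x 0)) f • y := by
  induction x using DirectSum.induction_on with
  | zero =>
    have h : anchorMap ((0 : GrSec V (AltFib V)) 0) = 0 := map_zero _
    rw [h, dirDeriv_zero_left, map_zero, LinearMap.zero_apply, LinearMap.zero_apply, smul_zero,
      zero_smul, add_zero]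
  | add x x' hx hx' =>
    have h : anchorMap ((x + x') 0) = anchorMap (x 0) + anchorMap (x' 0) := map_add _ _ _
    rw [h, dirDeriv_add_left, map_add, LinearMap.add_apply, LinearMap.add_apply, hx, hx', smul_add,
      add_smul]
    abel
  | of a s =>
    induction y using DirectSum.induction_on with
    | zero => rw [smul_zero, map_zero, smul_zero, smul_zero, add_zero]
    | add y y' hy hy' =>
      rw [smul_add, map_add, hy, hy', map_add, smul_add, smul_add]
      abel
    | of b t =>
      have h0 : anchorMap ((homog (F := AltFib V) a s) 0) = anchorDeg a s := by
        cases a with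
        | zero => rw [DirectSum.of_eq_same]; rfl
        | succ a => rw [DirectSum.of_eq_of_ne _ _ _ (by simp)]; exact map_zero _
      change nrGr (homog a s) (f • homog b t) = f • nrGr (homog a s) (homog b t) +
        dirDeriv (anchorMap ((homog (F := AltFib V) a s) 0)) f • homog b t
      rw [h0, ← homog_fun_smul, nrGr_eq_nrBracket, nrGr_eq_nrBracket, nrBracket, nrBracket,
        insertSec_fun_smul_left, insertSec_fun_smul_right, dirDeriv_fun_smul_right,
        anchorDeg_fun_smul, dirDeriv_fun_smul_left]
      simp only [homog_add, homog_fun_smul, smul_add, smul_sub, fun_smul_comm]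
      abel

theorem insertSec_zero_apply (s t : Sec V (Alt V 1)) (x v : V) :
    ev (insertSec 0 0 s t x) [v] = ev (t x) [ev (s x) [v]] := by
  have := ((isAlt_ev (t x)).linear [v] []).map_zero
  simp only [List.singleton_append] at this
  rw [ev_insertSec, ins_cons, ins_nil, ins_nil, contr_apply, contr_apply, bar_apply,
    supp_ev (s x) [] (by simp), smul_zero, this, add_zero]

/-- By the product rule the derivative of ρ(t) along ρ(s) is ρ(ρ(s)(t)) + t(ρ(s)), that is ρ(ρ(s)(t)
+ i_s t); antisymmetrizing gives the claim. -/
theorem anchorMap_nrGr (s t : Sec V (AltFib V 0)) :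
    anchorMap (nrGr (homog (F := AltFib V) 0 s) (homog (F := AltFib V) 0 t) 0) =
      lieBr (anchorMap s) (anchorMap t) := by
  have h : nrGr (homog (F := AltFib V) 0 s) (homog (F := AltFib V) 0 t) =
      homog (F := AltFib V) 0 (insertSec 0 0 s t - insertSec 0 0 t s +
        dirDeriv (anchorMap s) t - dirDeriv (anchorMap t) s) := by
    rw [nrGr_eq_nrBracket, nrBracket, homog_sub, homog_add, homog_sub, Nat.zero_mul, pow_zero,
      one_smul]
    rfl
  have hρ : ∀ (s : Sec V (AltFib V 0)) (x : V), anchorMap s x = ev (s x) [x] :=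
    anchorDeg_apply 0
  have hd : ∀ (s : Sec V (AltFib V 0)) (x v : V), fderiv ℝ (anchorMap s) x v =
    ev (fderiv ℝ s x v) [x] + ev (s x) [v] := fderiv_anchorDeg 0
  rw [h, DirectSum.of_eq_same]
  ext x
  have hi : ∀ s t : Sec V (Alt V 1), anchorMap (insertSec 0 0 s t) x = ev (t x) [ev (s x) [x]] :=
    fun s t => (anchorDeg_apply 0 _ x).trans (insertSec_zero_apply s t x x)
  change _ = fderiv ℝ (anchorMap t) x (anchorMap s x) - fderiv ℝ (anchorMap s) x (anchorMap t x)
  rw [hd, hd, map_sub, map_add, map_sub, Sec.sub_apply, Sec.add_apply, Sec.sub_apply, hi, hi,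
    hρ (dirDeriv _ _), hρ (dirDeriv _ _), dirDeriv_apply, dirDeriv_apply, hρ s, hρ t]
  abel

end NijenhuisRichardson

/-! ### Smoothness of integrals depending on a parameter -/

section ParametricIntegral

set_option linter.unusedSectionVars false

variable {E : Type*} [NormedAddCommGroup E] [NormedSpace ℝ E] [FiniteDimensional ℝ E]
variable {F : Type*} [NormedAddCommGroup F] [NormedSpace ℝ F] [CompleteSpace F]

theorem hasFDerivAt_intervalIntegral_param {g : ℝ → E → F} {n : ℕ}
    (hg : ContDiff ℝ (n + 1 : ℕ) (Function.uncurry g)) (x : E) :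
    HasFDerivAt (fun x => ∫ t in (0 : ℝ)..1, g t x) (∫ t in (0 : ℝ)..1, fderiv ℝ (g t) x) x := by
  have hne : ((n + 1 : ℕ) : WithTop ℕ∞) ≠ 0 := by simp
  have hdg : Differentiable ℝ (Function.uncurry g) := hg.differentiable hne
  have hslice : ∀ t, Differentiable ℝ (g t) := fun t =>
    hdg.comp (f := fun x => (t, x)) (by fun_prop)
  have hfc : Continuous (fun p : ℝ × E => fderiv ℝ (g p.1) p.2) := by
    have h1 : ∀ p : ℝ × E, fderiv ℝ (g p.1) p.2 =
        (fderiv ℝ (Function.uncurry g) p).comp (ContinuousLinearMap.inr ℝ ℝ E) := by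
      intro p
      have := (hdg (p.1, p.2)).hasFDerivAt.comp p.2 (hasFDerivAt_prodMk_right p.1 p.2)
      exact this.fderiv
    simp only [h1]
    exact (hg.continuous_fderiv hne).clm_comp continuous_const
  -- A constant bound on the compact set [0,1] × closed unit ball dominates the derivative.
  obtain ⟨C, hC⟩ := ((isCompact_Icc (a := (0 : ℝ)) (b := 1)).prod
    (isCompact_closedBall x 1)).exists_bound_of_continuousOn hfc.continuousOn
  refine intervalIntegral.hasFDerivAt_integral_of_dominated_of_fderiv_le
    (F := fun x t => g t x) (F' := fun x t => fderiv ℝ (g t) x) (bound := fun _ => C)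
    (Metric.ball_mem_nhds x one_pos) (Filter.Eventually.of_forall fun y => ?_) ?_ ?_ ?_ ?_ ?_
  · exact (hg.continuous.comp (by fun_prop : Continuous fun t => (t, y))).aestronglyMeasurable
  · exact (hg.continuous.comp (by fun_prop : Continuous fun t => (t, x))).intervalIntegrable _ _
  · exact (hfc.comp (by fun_prop : Continuous fun t => (t, x))).aestronglyMeasurable
  · refine Filter.Eventually.of_forall fun t ht y hy => hC (t, y) ⟨?_, ?_⟩
    · rw [Set.uIoc_of_le zero_le_one] at ht
      exact Set.Ioc_subset_Icc_self ht
    · exact Metric.ball_subset_closedBall hy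
  · exact intervalIntegrable_const
  · exact Filter.Eventually.of_forall fun t _ y _ => (hslice t y).hasFDerivAt

theorem contDiff_intervalIntegral_param {g : ℝ → E → F} (hg : ContDiff ℝ ∞ (Function.uncurry g)) :
    ContDiff ℝ ∞ fun x => ∫ t in (0 : ℝ)..1, g t x := by
  rw [contDiff_infty]
  intro n
  have hg' : ContDiff ℝ n (Function.uncurry g) := hg.of_le (by exact_mod_cast le_top)
  clear hg
  induction n generalizing g with
  | zero =>
    exact contDiff_zero.2
      (intervalIntegral.continuous_parametric_intervalIntegral_of_continuous' (by
        exact (hg'.continuous.comp continuous_swap)) _ _)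
  | succ n ih =>
    have hd := hasFDerivAt_intervalIntegral_param hg'
    have hdg : Differentiable ℝ (Function.uncurry g) := hg'.differentiable (by simp)
    push_cast
    -- Derivatives in a fixed direction y are again F-valued integrals of the same kind, so the
    -- induction hypothesis applies.
    rw [contDiff_succ_iff_fderiv_apply]
    refine ⟨fun x => (hd x).differentiableAt, by simp, fun y => ?_⟩
    have hsl : ∀ t x, fderiv ℝ (g t) x y = fderiv ℝ (Function.uncurry g) (t, x) (0, y) := by
      intro t x
      have := ((hdg (t, x)).hasFDerivAt.comp x (hasFDerivAt_prodMk_right t x)).fderiv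
      have h2 : fderiv ℝ (g t) x = _ := this
      rw [h2]
      simp
    have hsm : ContDiff ℝ n (Function.uncurry fun t x => fderiv ℝ (g t) x y) := by
      have : (Function.uncurry fun t x => fderiv ℝ (g t) x y) =
          fun p : ℝ × E => fderiv ℝ (Function.uncurry g) p (0, y) := by
        funext p; exact hsl p.1 p.2
      rw [this]
      exact (hg'.fderiv_right (m := n) (by push_cast; exact le_rfl)).clm_apply contDiff_const
    have heq : (fun x => fderiv ℝ (fun x => ∫ t in (0 : ℝ)..1, g t x) x y) =
        fun x => ∫ t in (0 : ℝ)..1, fderiv ℝ (g t) x y := by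
      funext x
      rw [(hd x).fderiv]
      have hi : Continuous fun t => fderiv ℝ (g t) x := by
        have h1 : ∀ t, fderiv ℝ (g t) x =
            (fderiv ℝ (Function.uncurry g) (t, x)).comp (ContinuousLinearMap.inr ℝ ℝ E) :=
          fun t => ((hdg (t, x)).hasFDerivAt.comp x (hasFDerivAt_prodMk_right t x)).fderiv
        simp only [h1]
        exact ((hg'.continuous_fderiv (by simp)).comp (by fun_prop)).clm_comp continuous_const
      exact ContinuousLinearMap.intervalIntegral_apply (hi.intervalIntegrable _ _) y
    rw [heq]
    exact ih hsm

end ParametricIntegral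

/-! ### A homotopy for the contraction with the Euler field -/

section Homotopy

set_option linter.unusedSectionVars false

variable {V : Type*} [NormedAddCommGroup V] [NormedSpace ℝ V] [FiniteDimensional ℝ V]

/-- The integrand of the homotopy contracting along the range of a projection `P`. -/
def homotopyIntegrand (P : V →L[ℝ] V) {j : ℕ} (θ : Sec V (Alt V j)) (t : ℝ) (x : V) :
    Alt V (j + 1) :=
  t ^ j • (extDeriv θ (x + (t - 1) • P x)).compContinuousLinearMap P

theorem contDiff_homotopyIntegrand (P : V →L[ℝ] V) {j : ℕ} (θ : Sec V (Alt V j)) :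
    ContDiff ℝ ∞ (Function.uncurry (homotopyIntegrand P θ)) := by
  have h1 : ContDiff ℝ ∞ (fderiv ℝ θ) := θ.contDiff.fderiv_right (by simp)
  have h2 : ContDiff ℝ ∞ fun p : ℝ × V => p.2 + (p.1 - 1) • P p.2 := by fun_prop
  have h3 : ContDiff ℝ ∞ fun p : ℝ × V =>
      (ContinuousAlternatingMap.compContinuousLinearMapCLM P : Alt V (j + 1) →L[ℝ] Alt V (j + 1))
      (ContinuousAlternatingMap.alternatizeUncurryFinCLM ℝ V V
        (fderiv ℝ θ (p.2 + (p.1 - 1) • P p.2))) :=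
    (ContinuousLinearMap.contDiff _).comp ((ContinuousLinearMap.contDiff _).comp (h1.comp h2))
  exact (contDiff_fst.pow j).smul h3

theorem fderiv_comp_eq {P : V →L[ℝ] V} {j : ℕ} {θ : Sec V (Alt V j)}
    (hP : ∀ x (v : Fin j → V), θ x (P ∘ v) = θ x v) (x w : V) (v : Fin j → V) :
    fderiv ℝ θ x w (P ∘ v) = fderiv ℝ θ x w v := by
  have h : ∀ v : Fin j → V, fderiv ℝ (fun y => θ y v) x w = fderiv ℝ θ x w v := by
    intro v
    have := ((ContinuousAlternatingMap.apply ℝ V V v).hasFDerivAt.comp x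
      (θ.differentiableAt x).hasFDerivAt).fderiv
    have h2 : fderiv ℝ (fun y => θ y v) x = _ := this
    rw [h2]
    rfl
  rw [← h, ← h]
  simp only [hP]

/-- Cartan's formula: with φ_t(x) = x + (t - 1)Px, the pullback of θ is t^j θ(φ_t(x)) because θ sees
only the P-parts of its arguments. The right side is its t-derivative, and the contraction of dθ
gives all of it since the contraction of θ vanishes. -/
theorem homotopyIntegrand_apply {P : V →L[ℝ] V} (hPP : ∀ x, P (P x) = P x) {j : ℕ}
    {θ : Sec V (Alt V j)} (hP : ∀ x (v : Fin j → V), θ x (P ∘ v) = θ x v)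
    (hk : ∀ x, contr x (ev (θ x)) = 0) (t : ℝ) (x : V) (v : Fin j → V) :
    homotopyIntegrand P θ t x (Fin.cons x v) =
      t ^ j • fderiv ℝ θ (x + (t - 1) • P x) (P x) v +
        (j * t ^ (j - 1)) • θ (x + (t - 1) • P x) v := by
  set y := x + (t - 1) • P x with hy
  have hPy : P y = t • P x := by
    rw [hy, map_add, map_smul, hPP]
    module
  have hc : P ∘ (Fin.cons x v : Fin (j + 1) → V) = Fin.cons (P x) (P ∘ v) := by
    funext i
    refine Fin.cases ?_ (fun i => ?_) i <;> simp
  have h1 : homotopyIntegrand P θ t x (Fin.cons x v) =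
      t ^ j • extDeriv θ y (Fin.cons (P x) (P ∘ v)) := by
    rw [← hc]; rfl
  rw [h1, extDeriv, ContinuousAlternatingMap.alternatizeUncurryFin_apply, Fin.sum_univ_succ, smul_add]
  congr 1
  · simp [← fderiv_comp_eq hP y (P x) v]
  · cases j with
    | zero => simp
    | succ k =>
      have hkz : koszul k θ = 0 := by
        ext1 z
        apply ev_injective
        rw [ev_koszul, hk, Sec.zero_apply, ev_zero]
      -- Obtained by differentiating θ(y)(y, u) = 0 in y and using Py = tPx. The factor t, taken
      -- from t^(k+1), makes the formula valid at t = 0 without division.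
      have hD : ∀ w (u : Fin k → V), t • fderiv ℝ θ y w (Fin.cons (P x) (P ∘ u)) =
          -θ y (Fin.cons w u) := by
        intro w u
        have h2 : fderiv ℝ (koszul k θ) y w u = 0 := by
          rw [hkz]
          have : (⇑(0 : Sec V (Alt V k)) : V → Alt V k) = fun _ => 0 := rfl
          rw [this]
          simp
        rw [fderiv_koszul] at h2
        have h3 : fderiv ℝ θ y w (Fin.cons y u) = -θ y (Fin.cons w u) := eq_neg_of_add_eq_zero_left h2
        rw [← h3, ← fderiv_comp_eq hP y w (Fin.cons y u)]
        have h4 : P ∘ (Fin.cons y u : Fin (k + 1) → V) = Fin.cons (t • P x) (P ∘ u) := by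
          funext i
          refine Fin.cases ?_ (fun i => ?_) i <;> simp [hPy]
        rw [h4]
        exact (congrArg (fun φ : Alt V k => φ (P ∘ u))
          ((fderiv ℝ θ y w).curryLeft.map_smul t (P x))).symm
      have hterm : ∀ i : Fin (k + 1), t ^ (k + 1) • ((-1) ^ ((i.succ : Fin (k + 2)) : ℕ) •
          fderiv ℝ θ y ((Fin.cons (P x) (P ∘ v) : Fin (k + 2) → V) i.succ)
            (i.succ.removeNth (Fin.cons (P x) (P ∘ v) : Fin (k + 2) → V))) = t ^ k • θ y v := by
        intro i
        have h5 : i.succ.removeNth (Fin.cons (P x) (P ∘ v) : Fin (k + 2) → V) =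
            Fin.cons (P x) (P ∘ i.removeNth v) := by
          funext m
          refine Fin.cases ?_ (fun m => ?_) m
          · simp [Fin.removeNth_apply]
          · simp [Fin.removeNth_apply]
        have h6 : θ y (Fin.cons (P (v i)) (i.removeNth v)) = (-1) ^ (i : ℕ) • θ y v := by
          have h7 := (θ y).neg_one_pow_smul_map_insertNth i (v i) (i.removeNth v)
          rw [Fin.insertNth_self_removeNth] at h7
          have h8 : P ∘ (Fin.cons (P (v i)) (i.removeNth v) : Fin (k + 1) → V) =
              P ∘ (Fin.cons (v i) (i.removeNth v) : Fin (k + 1) → V) := by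
            funext m
            refine Fin.cases ?_ (fun m => ?_) m <;> simp [hPP]
          rw [h7, ← hP, h8, hP]
          rfl
        rw [h5, Fin.cons_succ, pow_succ, mul_smul, smul_comm t, Function.comp_apply, hD, h6,
          Fin.val_succ]
        rcases Nat.even_or_odd (i : ℕ) with h | h
        · simp [h.neg_one_pow, pow_succ]
        · simp [h.neg_one_pow, pow_succ]
      rw [Finset.smul_sum, Finset.sum_congr rfl fun i _ => hterm i]
      rw [Finset.sum_const, Finset.card_univ, Fintype.card_fin, ← Nat.cast_smul_eq_nsmul ℝ, smul_smul,
        Nat.add_sub_cancel]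

/-- The primitive is the integral over [0,1] of the integrand, so its contraction is the difference
of t^j θ(x + (t - 1)Px) between t = 1 and t = 0. -/
theorem exists_koszul_eq {P : V →L[ℝ] V} (hPP : ∀ x, P (P x) = P x) {j : ℕ}
    {θ : Sec V (Alt V j)} (hP : ∀ x (v : Fin j → V), θ x (P ∘ v) = θ x v)
    (hk : ∀ x, contr x (ev (θ x)) = 0) (h0 : j = 0 → ∀ x, P x = 0 → θ x = 0) :
    ∃ η : Sec V (Alt V (j + 1)), koszul j η = θ ∧ ∀ x v, η x (P ∘ v) = η x v := by
  have hint : ∀ x, IntervalIntegrable (fun t => homotopyIntegrand P θ t x) MeasureTheory.volume 0 1 := by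
    intro x
    exact ((contDiff_homotopyIntegrand P θ).continuous.comp
      (by fun_prop : Continuous fun t => (t, x))).intervalIntegrable _ _
  have happly : ∀ x (v : Fin (j + 1) → V), (∫ t in (0 : ℝ)..1, homotopyIntegrand P θ t x) v =
      ∫ t in (0 : ℝ)..1, homotopyIntegrand P θ t x v := fun x v =>
    ((ContinuousAlternatingMap.apply ℝ V V v).intervalIntegral_comp_comm (hint x)).symm
  refine ⟨mkSec (fun x => ∫ t in (0 : ℝ)..1, homotopyIntegrand P θ t x)
    (contDiff_intervalIntegral_param (contDiff_homotopyIntegrand P θ)), ?_, ?_⟩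
  · ext x v
    rw [koszul_apply, mkSec_apply, happly]
    simp only [homotopyIntegrand_apply hPP hP hk]
    have hder : ∀ t : ℝ, HasDerivAt (fun t : ℝ => t ^ j • θ (x + (t - 1) • P x) v)
        (t ^ j • fderiv ℝ θ (x + (t - 1) • P x) (P x) v +
        (j * t ^ (j - 1)) • θ (x + (t - 1) • P x) v) t := by
      intro t
      have h1 : HasDerivAt (fun t : ℝ => x + (t - 1) • P x) (P x) t := by
        simpa using (((hasDerivAt_id t).sub_const 1).smul_const (P x)).const_add x
      have h2 := (θ.differentiableAt (x + (t - 1) • P x)).hasFDerivAt.comp_hasDerivAt t h1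
      have h3 := (ContinuousAlternatingMap.apply ℝ V V v).hasFDerivAt.comp_hasDerivAt t h2
      exact (hasDerivAt_pow j t).smul h3
    rw [intervalIntegral.integral_eq_sub_of_hasDerivAt fun t _ => hder t]
    -- At t = 0 the factor t^j vanishes unless j = 0; for j = 0 the endpoint x - Px lies in the
    -- kernel of P, where θ is assumed to vanish.
    · cases j with
      | zero =>
        rw [h0 rfl (x + ((0 : ℝ) - 1) • P x) (by rw [map_add, map_smul, hPP]; module)]
        simp
      | succ j => simp
    · have h1 : Continuous fun t => homotopyIntegrand P θ t x (Fin.cons x v) :=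
        (ContinuousAlternatingMap.apply ℝ V V (Fin.cons x v)).continuous.comp
          ((contDiff_homotopyIntegrand P θ).continuous.comp (by fun_prop : Continuous fun t => (t, x)))
      simp only [homotopyIntegrand_apply hPP hP hk] at h1
      exact h1.intervalIntegrable _ _
  · intro x v
    rw [mkSec_apply, happly, happly]
    congr 1
    funext t
    have : P ∘ P ∘ v = P ∘ v := funext fun i => hPP _
    change t ^ j • extDeriv θ _ (P ∘ P ∘ v) = t ^ j • extDeriv θ _ (P ∘ v)
    rw [this]

end Homotopy

/-! ### Exactness of the Koszul complex on Γ(K) and the foliation -/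

section Exactness

set_option linter.unusedSectionVars false

variable {V : Type*} [NormedAddCommGroup V] [NormedSpace ℝ V] [FiniteDimensional ℝ V]

theorem exists_projection (W : Submodule ℝ V) :
    ∃ P : V →L[ℝ] V, (∀ x, P (P x) = P x) ∧ ∀ x, P x = 0 ↔ x ∈ W := by
  obtain ⟨g, hg⟩ := W.mkQ.exists_rightInverse_of_surjective W.range_mkQ
  have h : ∀ x, W.mkQ (g x) = x := fun x => LinearMap.congr_fun hg x
  refine ⟨LinearMap.toContinuousLinearMap (g ∘ₗ W.mkQ), fun x => ?_, fun x => ?_⟩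
  · simp only [LinearMap.coe_toContinuousLinearMap', LinearMap.comp_apply, h]
  · simp only [LinearMap.coe_toContinuousLinearMap', LinearMap.comp_apply]
    constructor
    · intro hx
      have := h (W.mkQ x)
      rw [hx, map_zero] at this
      exact (Submodule.Quotient.mk_eq_zero W).1 this.symm
    · intro hx
      rw [(Submodule.Quotient.mk_eq_zero W).2 hx |> (show W.mkQ x = 0 from ·), map_zero]

theorem apply_comp_projection {W : Submodule ℝ V} {P : V →L[ℝ] V} (hPP : ∀ x, P (P x) = P x)
    (hW : ∀ x, P x = 0 → x ∈ W) {j : ℕ} {φ : Alt V j} (hφ : ∀ v i, v i ∈ W → φ v = 0)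
    (v : Fin j → V) : φ (P ∘ v) = φ v := by
  induction j with
  | zero => congr 1; exact Subsingleton.elim _ _
  | succ j ih =>
    obtain ⟨a, u, rfl⟩ : ∃ a u, v = Fin.cons a u := ⟨v 0, Fin.tail v, (Fin.cons_self_tail v).symm⟩
    have h1 : φ.curryLeft a = φ.curryLeft (P a) := by
      rw [← sub_eq_zero, ← map_sub]
      ext u
      exact hφ _ 0 (hW _ (by simp [hPP]))
    have h2 : P ∘ (Fin.cons a u : Fin (j + 1) → V) = Fin.cons (P a) (P ∘ u) := by
      funext i
      refine Fin.cases ?_ (fun i => ?_) i <;> simp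
    have h3 := ih (φ := φ.curryLeft (P a)) (fun u i hu => hφ (Fin.cons (P a) u) i.succ hu) u
    rw [h2]
    exact h3.trans (congrArg (fun ψ : Alt V j => ψ u) h1.symm)

/-- Post-composition of form-valued sections with an endomorphism of `V`. -/
def postComp (A : V →L[ℝ] V) (j : ℕ) : Sec V (Alt V j) →ₗ[SmoothFun V] Sec V (Alt V j) :=
  mapSec (ContinuousLinearMap.compContinuousAlternatingMapCLM ℝ V V V (Fin j) A)

theorem postComp_apply (A : V →L[ℝ] V) (j : ℕ) (s : Sec V (Alt V j)) (x : V) (v : Fin j → V) :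
    postComp A j s x v = A (s x v) := rfl

theorem koszul_postComp (A : V →L[ℝ] V) (j : ℕ) (s : Sec V (Alt V (j + 1))) :
    koszul j (postComp A (j + 1) s) = postComp A j (koszul j s) := by
  ext x v
  rfl

theorem contr_ev_postComp (A : V →L[ℝ] V) {j : ℕ} {s : Sec V (Alt V j)} {x : V}
    (h : contr x (ev (s x)) = 0) : contr x (ev (postComp A j s x)) = 0 := by
  funext l
  by_cases hl : (x :: l).length = j
  · obtain ⟨v, hv⟩ := exists_ofFn hl
    have h1 := congrFun h l
    rw [contr_apply, hv, ev_ofFn] at h1 ⊢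
    rw [postComp_apply, h1]
    exact A.map_zero
  · exact supp_ev _ _ hl

/-- Writing θ = (1 - P)θ + Pθ, take η = (1 - P)η₁ + Pη₂, where η₁ is the primitive of θ by scaling
to the origin and η₂ that of Pθ by scaling along P. The first summand has values in W = ker P; the
second vanishes on arguments in W because η₂ does. -/
theorem exists_koszul_eq_of_mem {W : Submodule ℝ V} {j : ℕ} {θ : Sec V (Alt V j)}
    (hk : ∀ x, contr x (ev (θ x)) = 0) (hW : ∀ x v i, v i ∈ W → θ x v ∈ W)
    (h0 : j = 0 → θ 0 = 0 ∧ ∀ x ∈ W, ∀ v, θ x v ∈ W) :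
    ∃ η ∈ secK W j, koszul j η = θ := by
  obtain ⟨P, hPP, hPW⟩ := exists_projection W
  obtain ⟨η₁, h₁, -⟩ := exists_koszul_eq (P := ContinuousLinearMap.id ℝ V) (fun _ => rfl)
    (θ := θ) (fun _ _ => rfl) hk fun hj x hx => by
      rw [show x = 0 from hx]
      exact (h0 hj).1
  obtain ⟨η₂, h₂, h₂'⟩ := exists_koszul_eq hPP (θ := postComp P j θ)
    (fun x v => apply_comp_projection hPP (fun x hx => (hPW x).1 hx)
      (fun v i hi => (hPW _).2 (hW x v i hi)) v)
    (fun x => contr_ev_postComp P (hk x)) fun hj x hx => by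
      ext v
      exact (hPW _).2 ((h0 hj).2 x ((hPW x).1 hx) v)
  refine ⟨postComp (ContinuousLinearMap.id ℝ V - P) (j + 1) η₁ + postComp P (j + 1) η₂, ?_, ?_⟩
  · refine Submodule.add_mem _ (fun x w hw v => ?_) fun x w hw v => ?_
    · change η₁ x (Fin.cons w v) - P (η₁ x (Fin.cons w v)) ∈ W
      rw [← hPW, map_sub, hPP, sub_self]
    · change P (η₂ x (Fin.cons w v)) ∈ W
      rw [← h₂', (η₂ x).map_coord_zero 0 ((hPW w).2 hw), map_zero]
      exact W.zero_mem
  · rw [map_add, koszul_postComp, koszul_postComp, h₁, h₂]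
    ext x v
    simp [postComp_apply, hPP]

theorem exact_secK_succ (W : Submodule ℝ V) (j : ℕ) {s : Sec V (Alt V (j + 2))}
    (hs : s ∈ secK W (j + 1)) (h : koszul (j + 1) s = 0) :
    ∃ η ∈ secK W (j + 2), koszul (j + 2) η = s := by
  refine exists_koszul_eq_of_mem (fun x => ?_) (fun x => (mem_K_iff W).1 (hs x)) (by simp)
  rw [← ev_koszul, h, Sec.zero_apply, ev_zero]

theorem koszul_zero_eq_zero {s : Sec V (Alt V 1)} (h : anchorMap s = 0) : koszul 0 s = 0 := by
  ext x v
  rw [← anchorMap_eq_koszul, h]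
  rfl

theorem exact_secK_zero (W : Submodule ℝ V) {s : Sec V (Alt V 1)}
    (hs : s ∈ secK W 0) (h : anchorMap s = 0) : ∃ η ∈ secK W 1, koszul 1 η = s := by
  refine exists_koszul_eq_of_mem (fun x => ?_) (fun x => (mem_K_iff W).1 (hs x)) (by simp)
  rw [← ev_koszul, koszul_zero_eq_zero h, Sec.zero_apply, ev_zero]

theorem anchorMap_koszul (s : Sec V (Alt V 2)) : anchorMap (koszul 1 s) = 0 :=
  anchorDeg_koszul 0 s

/-- At w ∈ W the vector ρ(s)(w) = s(w)(w) lies in W, so a function vanishing on W is zero along the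
line through w in that direction. -/
theorem anchorMap_mem_foliation {W : Submodule ℝ V} {s : Sec V (Alt V 1)} (hs : s ∈ secK W 0) :
    anchorMap s ∈ foliation W := by
  refine ⟨(s 0).map_coord_zero 0 rfl, fun f hf w hw => ?_⟩
  have hX : anchorMap s w ∈ W := (mem_K_iff W).1 (hs w) (fun _ => w) 0 hw
  have h1 : HasDerivAt (fun t : ℝ => w + t • anchorMap s w) (anchorMap s w) 0 := by
    simpa using ((hasDerivAt_id (0 : ℝ)).smul_const (anchorMap s w)).const_add w
  have h2 : HasFDerivAt f (fderiv ℝ f w) (w + (0 : ℝ) • anchorMap s w) := by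
    rw [zero_smul, add_zero]
    exact (f.differentiableAt w).hasFDerivAt
  have h3 := h2.comp_hasDerivAt (0 : ℝ) h1
  have h4 : (f ∘ fun t : ℝ => w + t • anchorMap s w) = fun _ => 0 :=
    funext fun t => hf _ (W.add_mem hw (W.smul_mem t hX))
  rw [h4] at h3
  exact h3.unique (hasDerivAt_const _ _)

/-- Tested on the linear functions l ∘ P, which vanish on W: all functionals l kill P(X(w)), so X(w)
∈ ker P. -/
theorem mem_of_mem_foliation {W : Submodule ℝ V} {X : VecField V} (hX : X ∈ foliation W) {w : V}
    (hw : w ∈ W) : X w ∈ W := by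
  obtain ⟨P, -, hPW⟩ := exists_projection W
  rw [← hPW]
  refine (Module.forall_dual_apply_eq_zero_iff ℝ _).1 fun l => ?_
  let A : V →L[ℝ] ℝ := (LinearMap.toContinuousLinearMap l).comp P
  have h1 := hX.2 (mkSec A A.contDiff) (fun w hw => by
    rw [mkSec_apply]
    change l (P w) = 0
    rw [(hPW w).2 hw, map_zero]) w hw
  rw [dirDeriv_apply, coe_mkSec, A.fderiv] at h1
  exact h1

/-- The case j = 0 of `exists_koszul_eq_of_mem`, with X regarded as a V-valued 0-form. -/
theorem exists_anchorMap_eq {W : Submodule ℝ V} {X : VecField V} (hX : X ∈ foliation W) :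
    ∃ s ∈ secK W 0, anchorMap s = X := by
  let C : V →L[ℝ] Alt V 0 :=
    (ContinuousAlternatingMap.constOfIsEmptyLIE ℝ V V (Fin 0)).toContinuousLinearEquiv
  obtain ⟨η, hη, h⟩ := exists_koszul_eq_of_mem (W := W) (θ := mapSec C X)
    (fun x => funext fun l => supp_ev (mapSec C X x) (x :: l) (by simp)) (fun _ _ i => i.elim0)
    fun _ => ⟨by rw [mapSec_apply, hX.1, map_zero], fun x hx _ => mem_of_mem_foliation hX hx⟩
  refine ⟨η, hη, ?_⟩
  ext x
  rw [anchorMap_eq_koszul _ _ fun i => i.elim0, h]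
  rfl

theorem map_anchorMap (W : Submodule ℝ V) : (secK W 0).map anchorMap = foliation W := by
  refine le_antisymm ?_ fun X hX => exists_anchorMap_eq hX
  rintro _ ⟨s, hs, rfl⟩
  exact anchorMap_mem_foliation hs

theorem Sec.sum_apply {ι : Type*} {F : Type*} [NormedAddCommGroup F] [NormedSpace ℝ F]
    (I : Finset ι) (f : ι → Sec V F) (x : V) : (∑ i ∈ I, f i) x = ∑ i ∈ I, f i x :=
  map_sum (⟨⟨fun s => s x, rfl⟩, fun _ _ => rfl⟩ : Sec V F →+ F) f I

theorem secK_zero_fg (W : Submodule ℝ V) : (secK W 0).FG := by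
  let b := Module.finBasis ℝ (KFib W 0)
  let c : Fin _ → Sec V (Alt V 1) := fun i => inclK W 0 (mkSec (fun _ => b i) contDiff_const)
  suffices h : secK W 0 = Submodule.span (SmoothFun V) (Set.range c) by
    rw [h]
    exact Submodule.fg_span (Set.finite_range c)
  refine le_antisymm (fun s hs => ?_) ?_
  rotate_left
  · rw [Submodule.span_le]
    rintro _ ⟨i, rfl⟩
    exact inclK_mem_secK W _
  · have h : s = ∑ i, (mapSec (LinearMap.toContinuousLinearMap (b.coord i))
        (mapSec (retr W 0) s) : SmoothFun V) • c i := by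
      have h1 : mapSec (retr W 0) s = ∑ i, (mapSec (LinearMap.toContinuousLinearMap (b.coord i))
        (mapSec (retr W 0) s) : SmoothFun V) • mkSec (fun _ => b i) contDiff_const := by
        ext1 x
        rw [Sec.sum_apply]
        exact (b.sum_repr _).symm
      conv_lhs => rw [← inclK_retr W hs, h1, map_sum]
      rfl
    rw [h]
    refine Submodule.sum_mem _ fun i _ => Submodule.smul_mem _ _ (Submodule.subset_span ⟨i, rfl⟩)

theorem foliation_fg (W : Submodule ℝ V) : (foliation W).FG := by
  rw [← map_anchorMap]
  exact (secK_zero_fg W).map _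

/-- Both fields lift through ρ to Γ(K), which is closed under the bracket, and ρ intertwines the
brackets. -/
theorem lieBr_mem_foliation {W : Submodule ℝ V} {X Y : VecField V} (hX : X ∈ foliation W)
    (hY : Y ∈ foliation W) : lieBr X Y ∈ foliation W := by
  obtain ⟨s, hs, rfl⟩ := exists_anchorMap_eq hX
  obtain ⟨t, ht, rfl⟩ := exists_anchorMap_eq hY
  obtain ⟨u, hu, h⟩ := exists_nrBracket_eq W hs ht
  rw [← anchorMap_nrGr, nrGr_eq_nrBracket, h, DirectSum.of_eq_same]
  exact anchorMap_mem_foliation hu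

theorem K_eq_bot (W : Submodule ℝ V) {j : ℕ} (hj : Module.finrank ℝ V ≤ j) : K W j = ⊥ := by
  rw [eq_bot_iff]
  intro φ _
  rw [Submodule.mem_bot]
  ext v
  refine φ.toAlternatingMap.map_linearDependent v fun hv => ?_
  have := hv.fintype_card_le_finrank
  simp at this
  omega

end Exactness

/-! ### Higher Jacobi identities when only unary and binary brackets occur -/

section Multibracket

variable {M : Type*} [AddCommGroup M] [Module ℝ M]

/-- A linear map as a multilinear map in one variable. -/
def linearToMulti (A : M →ₗ[ℝ] M) : MultilinearMap ℝ (fun _ : Fin 1 => M) M where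
  toFun x := A (x 0)
  map_update_add' x i a b := by
    obtain rfl := Subsingleton.elim i 0
    simp
  map_update_smul' x i c a := by
    obtain rfl := Subsingleton.elim i 0
    simp

/-- A bilinear map as a multilinear map in two variables. -/
def bilinearToMulti (B : M →ₗ[ℝ] M →ₗ[ℝ] M) : MultilinearMap ℝ (fun _ : Fin 2 => M) M where
  toFun x := B (x 0) (x 1)
  map_update_add' x i a b := by
    rcases Fin.exists_fin_two.1 ⟨i, rfl⟩ with rfl | rfl <;> simp
  map_update_smul' x i c a := by
    rcases Fin.exists_fin_two.1 ⟨i, rfl⟩ with rfl | rfl <;> simp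

/-- The multibrackets with given unary and binary bracket, all others being zero. -/
def multibracket (A : M →ₗ[ℝ] M) (B : M →ₗ[ℝ] M →ₗ[ℝ] M) :
    ∀ k : ℕ, MultilinearMap ℝ (fun _ : Fin k => M) M
  | 1 => linearToMulti A
  | 2 => bilinearToMulti B
  | _ => 0

variable (A : M →ₗ[ℝ] M) (B : M →ₗ[ℝ] M →ₗ[ℝ] M)

theorem multibracket_eq_zero {k : ℕ} (h1 : k ≠ 1) (h2 : k ≠ 2) : multibracket A B k = 0 := by
  rcases k with _ | _ | _ | k
  · rfl
  · exact absurd rfl h1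
  · exact absurd rfl h2
  · rfl

/-- The sum in the `n`-th higher Jacobi identity. -/
def jacobiator {n : ℕ} (d : Fin n → ℕ) (y : Fin n → M) : M :=
  ∑ S ∈ (Finset.univ : Finset (Finset (Fin n))) with S.Nonempty,
    ((-1) ^ (S.card * Sᶜ.card) * unshuffleSign d S) •
      multibracket A B (Sᶜ.card + 1)
        (Fin.cons (multibracket A B S.card (y ∘ S.orderEmbOfFin rfl))
          (y ∘ Sᶜ.orderEmbOfFin rfl))

/-- A finite subset has only one increasing enumeration, so explicit ones may replace
`orderEmbOfFin`. -/
theorem jacobi_term {n k l : ℕ} (S : Finset (Fin n)) (hS : S.card = k) (hT : Sᶜ.card = l)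
    {f : Fin k → Fin n} (hf : ∀ x, f x ∈ S) (hf' : StrictMono f) {g : Fin l → Fin n}
    (hg : ∀ x, g x ∈ Sᶜ) (hg' : StrictMono g) (d : Fin n → ℕ) (y : Fin n → M) :
    ((-1 : ℝ) ^ (S.card * Sᶜ.card) * unshuffleSign d S) •
      multibracket A B (Sᶜ.card + 1) (Fin.cons (multibracket A B S.card (y ∘ S.orderEmbOfFin rfl))
        (y ∘ Sᶜ.orderEmbOfFin rfl)) =
    ((-1 : ℝ) ^ (k * l) * unshuffleSign d S) •
      multibracket A B (l + 1) (Fin.cons (multibracket A B k (y ∘ f)) (y ∘ g)) := by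
  subst hS hT
  rw [← Finset.orderEmbOfFin_unique rfl hf hf', ← Finset.orderEmbOfFin_unique rfl hg hg']

theorem jacobi_term_eq_zero {n : ℕ} {S : Finset (Fin n)} (h : 3 ≤ S.card ∨ 2 ≤ Sᶜ.card)
    (y : Fin n → M) :
    multibracket A B (Sᶜ.card + 1) (Fin.cons (multibracket A B S.card (y ∘ S.orderEmbOfFin rfl))
      (y ∘ Sᶜ.orderEmbOfFin rfl)) = 0 := by
  rcases h with h | h
  · rw [multibracket_eq_zero A B (k := S.card) (by omega) (by omega)]
    exact MultilinearMap.map_coord_zero _ 0 rfl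
  · rw [multibracket_eq_zero A B (k := Sᶜ.card + 1) (by omega) (by omega)]
    rfl

theorem jacobiator_of_four_le {n : ℕ} (hn : 4 ≤ n) (d : Fin n → ℕ) (y : Fin n → M) :
    jacobiator A B d y = 0 := by
  refine Finset.sum_eq_zero fun S _ => ?_
  have h := S.card_add_card_compl
  rw [Fintype.card_fin] at h
  rw [jacobi_term_eq_zero A B (by omega), smul_zero]

theorem jacobiator_one (d : Fin 1 → ℕ) (y : Fin 1 → M) (h : A (A (y 0)) = 0) :
    jacobiator A B d y = 0 := by
  rw [jacobiator, show (Finset.univ : Finset (Finset (Fin 1))).filter Finset.Nonempty = {{0}} by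
    decide, Finset.sum_singleton, jacobi_term A B {0} (k := 1) (l := 0) (f := ![0]) (g := ![])
    (by decide) (by decide) (by decide) (by decide) (by decide) (by decide)]
  exact (congrArg _ h).trans (smul_zero _)

theorem jacobiator_two (d : Fin 2 → ℕ) (y : Fin 2 → M) :
    jacobiator A B d y = -B (A (y 0)) (y 1) + ((-1 : ℝ) ^ (d 1 * d 0) • B (A (y 1)) (y 0) +
      A (B (y 0) (y 1))) := by
  have e0 : unshuffleSign d {0} = 1 := by
    simp [unshuffleSign, show ({0} : Finset (Fin 2))ᶜ = {1} by decide]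
  have e1 : unshuffleSign d {1} = -(-1) ^ (d 1 * d 0) := by
    simp [unshuffleSign, show ({1} : Finset (Fin 2))ᶜ = {0} by decide]
  have e01 : unshuffleSign d {0, 1} = 1 := by
    simp [unshuffleSign, show ({0, 1} : Finset (Fin 2))ᶜ = ∅ by decide]
  have m0 : multibracket A B (1 + 1) (Fin.cons (multibracket A B 1 (y ∘ ![0])) (y ∘ ![1])) =
    B (A (y 0)) (y 1) := rfl
  have m1 : multibracket A B (1 + 1) (Fin.cons (multibracket A B 1 (y ∘ ![1])) (y ∘ ![0])) =
    B (A (y 1)) (y 0) := rfl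
  have m01 : multibracket A B (0 + 1) (Fin.cons (multibracket A B 2 (y ∘ ![0, 1])) (y ∘ ![])) =
    A (B (y 0) (y 1)) := rfl
  rw [jacobiator, show (Finset.univ : Finset (Finset (Fin 2))).filter Finset.Nonempty =
    {{0}, {1}, {0, 1}} by decide, Finset.sum_insert (by decide), Finset.sum_insert (by decide),
    Finset.sum_singleton, jacobi_term A B {0} (k := 1) (l := 1) (f := ![0]) (g := ![1]) (by decide)
    (by decide) (by decide) (by decide) (by decide) (by decide),
    jacobi_term A B {1} (k := 1) (l := 1) (f := ![1]) (g := ![0]) (by decide)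
    (by decide) (by decide) (by decide) (by decide) (by decide),
    jacobi_term A B {0, 1} (k := 2) (l := 0) (f := ![0, 1]) (g := ![]) (by decide)
    (by decide) (by decide) (by decide) (by decide) (by decide), e0, e1, e01, m0, m1, m01]
  module

theorem jacobiator_three (d : Fin 3 → ℕ) (y : Fin 3 → M) :
    jacobiator A B d y = B (B (y 0) (y 1)) (y 2) -
      (-1 : ℝ) ^ (d 1 * d 2) • B (B (y 0) (y 2)) (y 1) +
      (-1 : ℝ) ^ (d 0 * d 1 + d 0 * d 2) • B (B (y 1) (y 2)) (y 0) := by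
  have e01 : unshuffleSign d {0, 1} = 1 := by
    simp [unshuffleSign, show ({0, 1} : Finset (Fin 3))ᶜ = {2} by decide]
  have e02 : unshuffleSign d {0, 2} = -(-1) ^ (d 2 * d 1) := by
    simp [unshuffleSign, show ({0, 2} : Finset (Fin 3))ᶜ = {1} by decide]
  have e12 : unshuffleSign d {1, 2} = (-1) ^ (d 1 * d 0) * (-1) ^ (d 2 * d 0) := by
    simp [unshuffleSign, show ({1, 2} : Finset (Fin 3))ᶜ = {0} by decide]
  have m01 : multibracket A B (1 + 1) (Fin.cons (multibracket A B 2 (y ∘ ![0, 1])) (y ∘ ![2])) =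
    B (B (y 0) (y 1)) (y 2) := rfl
  have m02 : multibracket A B (1 + 1) (Fin.cons (multibracket A B 2 (y ∘ ![0, 2])) (y ∘ ![1])) =
    B (B (y 0) (y 2)) (y 1) := rfl
  have m12 : multibracket A B (1 + 1) (Fin.cons (multibracket A B 2 (y ∘ ![1, 2])) (y ∘ ![0])) =
    B (B (y 1) (y 2)) (y 0) := rfl
  -- Singletons lead to an outer ternary bracket and the full set to an inner one, so only the pairs
  -- contribute.
  have hz : ∀ S ∈ ({{0}, {1}, {2}, {0, 1, 2}} : Finset (Finset (Fin 3))),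
      3 ≤ S.card ∨ 2 ≤ Sᶜ.card := by decide
  rw [jacobiator, show (Finset.univ : Finset (Finset (Fin 3))).filter Finset.Nonempty =
    {{0, 1}, {0, 2}, {1, 2}} ∪ {{0}, {1}, {2}, {0, 1, 2}} by decide,
    Finset.sum_union (by decide), Finset.sum_eq_zero (s := {{0}, {1}, {2}, {0, 1, 2}})
    fun S hS => by rw [jacobi_term_eq_zero A B (hz S hS), smul_zero],
    add_zero, Finset.sum_insert (by decide), Finset.sum_insert (by decide),
    Finset.sum_singleton, jacobi_term A B {0, 1} (k := 2) (l := 1) (f := ![0, 1]) (g := ![2])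
    (by decide) (by decide) (by decide) (by decide) (by decide) (by decide),
    jacobi_term A B {0, 2} (k := 2) (l := 1) (f := ![0, 2]) (g := ![1])
    (by decide) (by decide) (by decide) (by decide) (by decide) (by decide),
    jacobi_term A B {1, 2} (k := 2) (l := 1) (f := ![1, 2]) (g := ![0])
    (by decide) (by decide) (by decide) (by decide) (by decide) (by decide),
    e01, e02, e12, m01, m02, m12, pow_add, mul_comm (d 2) (d 1),
    mul_comm (d 1) (d 0), mul_comm (d 2) (d 0)]
  module

end Multibracket

/-! ### The algebroid on K, transported along the inclusion -/

section Algebroid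

set_option linter.unusedSectionVars false

variable {V : Type*} [NormedAddCommGroup V] [NormedSpace ℝ V] [FiniteDimensional ℝ V]
variable (W : Submodule ℝ V)

theorem inclGr_apply (g : GrSec V (KFib W)) (j : ℕ) : inclGr W g j = inclK W j (g j) :=
  DirectSum.map_apply _ _ _

/-- `inclGr` as a linear map. -/
def inclLin : GrSec V (KFib W) →ₗ[ℝ] GrSec V (AltFib V) :=
  { inclGr W with
    map_smul' := fun c g => DFinsupp.ext fun j => by
      change inclGr W (c • g) j = c • inclGr W g j
      rw [inclGr_apply, inclGr_apply]
      ext1 x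
      rfl }

theorem inclLin_apply (g : GrSec V (KFib W)) (j : ℕ) : inclLin W g j = inclK W j (g j) :=
  DirectSum.map_apply _ _ _

theorem inclLin_homog (j : ℕ) (s : Sec V (KFib W j)) :
    inclLin W (homog (F := KFib W) j s) = homog (F := AltFib V) j (inclK W j s) :=
  DirectSum.map_of _ _ _

theorem inclLin_fun_smul (f : SmoothFun V) (g : GrSec V (KFib W)) :
    inclLin W (f • g) = f • inclLin W g := by
  refine DFinsupp.ext fun j => ?_
  change inclLin W (f • g) j = f • inclLin W g j
  rw [inclLin_apply, inclLin_apply]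
  exact (inclK W j).map_smul f (g j)

theorem inclLin_injective : Function.Injective (inclLin W) := fun g h hgh =>
  DFinsupp.ext fun j => inclK_injective W j (by rw [← inclLin_apply, ← inclLin_apply, hgh])

/-- The retraction onto `Γ(K_•)`. -/
def retrLin : GrSec V (AltFib V) →ₗ[ℝ] GrSec V (KFib W) :=
  grLinear fun a =>
    { toFun := fun s => homog (F := KFib W) a (mapSec (retr W a) s)
      map_add' := fun s t => by rw [map_add, homog_add]
      map_smul' := fun c s => by
        rw [RingHom.id_apply, ← homog_smul]
        congr 1
        ext1 x
        exact (retr W a).map_smul c (s x) }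

theorem retrLin_homog (a : ℕ) (s : Sec V (AltFib V a)) :
    retrLin W (homog (F := AltFib V) a s) = homog (F := KFib W) a (mapSec (retr W a) s) :=
  grLinear_homog _ _ _

theorem inclLin_retrLin_homog {a : ℕ} {s : Sec V (AltFib V a)} (hs : s ∈ secK W a) :
    inclLin W (retrLin W (homog (F := AltFib V) a s)) = homog (F := AltFib V) a s := by
  rw [retrLin_homog, inclLin_homog, inclK_retr W hs]

/-- The unary bracket of the `L_∞`-algebroid. -/
def unary : GrSec V (KFib W) →ₗ[ℝ] GrSec V (KFib W) := retrLin W ∘ₗ koszulGr ∘ₗ inclLin W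

/-- The binary bracket of the `L_∞`-algebroid. -/
def binary : GrSec V (KFib W) →ₗ[ℝ] GrSec V (KFib W) →ₗ[ℝ] GrSec V (KFib W) :=
  (nrGr.compl₁₂ (inclLin W) (inclLin W)).compr₂ (retrLin W)

/-- The retraction loses nothing, since the Koszul differential of a section of K lies in K.
Identities for `unary` thereby reduce to those for `koszulGr`; `inclLin_binary` plays the same role
for the bracket. -/
theorem inclLin_unary (g : GrSec V (KFib W)) :
    inclLin W (unary W g) = koszulGr (inclLin W g) := by
  induction g using DirectSum.induction_on with
  | zero => simp only [map_zero]
  | add g h hg hh => simp only [map_add, hg, hh]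
  | of a s =>
    change inclLin W (retrLin W (koszulGr (inclLin W (homog a s)))) = koszulGr (inclLin W (homog a s))
    rw [inclLin_homog]
    cases a with
    | zero => rw [koszulGr_homog_zero, map_zero, map_zero]
    | succ a =>
      rw [koszulGr_homog_succ, inclLin_retrLin_homog]
      exact koszul_mem_secK W (inclK_mem_secK W s)

theorem inclLin_binary (g h : GrSec V (KFib W)) :
    inclLin W (binary W g h) = nrGr (inclLin W g) (inclLin W h) := by
  induction g using DirectSum.induction_on with
  | zero => simp only [map_zero, LinearMap.zero_apply]
  | add g g' hg hg' => simp only [map_add, LinearMap.add_apply, hg, hg']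
  | of a s =>
    induction h using DirectSum.induction_on with
    | zero => simp only [map_zero]
    | add h h' hh hh' => simp only [map_add, hh, hh']
    | of b t =>
      change inclLin W (retrLin W (nrGr (inclLin W (homog a s)) (inclLin W (homog b t)))) =
        nrGr (inclLin W (homog a s)) (inclLin W (homog b t))
      rw [inclLin_homog, inclLin_homog, nrGr_eq_nrBracket]
      obtain ⟨u, hu, h⟩ := exists_nrBracket_eq W (inclK_mem_secK W s) (inclK_mem_secK W t)
      rw [h, inclLin_retrLin_homog W hu]

theorem koszulGr_fun_smul (f : SmoothFun V) (g : GrSec V (AltFib V)) :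
    koszulGr (f • g) = f • koszulGr g := by
  induction g using DirectSum.induction_on with
  | zero => rw [smul_zero, map_zero, smul_zero]
  | add g h hg hh => rw [smul_add, map_add, map_add, smul_add, hg, hh]
  | of a s =>
    change koszulGr (f • homog a s) = f • koszulGr (homog a s)
    rw [← homog_fun_smul]
    cases a with
    | zero => rw [koszulGr_homog_zero, koszulGr_homog_zero, smul_zero]
    | succ a => rw [koszulGr_homog_succ, koszulGr_homog_succ, map_smul, homog_fun_smul]

/-- The multibrackets of the `L_∞`-algebroid. -/
def brackets : ∀ k : ℕ, MultilinearMap ℝ (fun _ : Fin k => GrSec V (KFib W)) (GrSec V (KFib W)) :=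
  multibracket (unary W) (binary W)

theorem brackets_one (x : Fin 1 → GrSec V (KFib W)) : brackets W 1 x = unary W (x 0) := rfl

theorem brackets_eq_zero {k : ℕ} (h1 : k ≠ 1) (h2 : k ≠ 2) : brackets W k = 0 :=
  multibracket_eq_zero _ _ h1 h2

theorem unary_degree (a : ℕ) (s : Sec V (KFib W a)) (m : ℕ) (h : m + 1 ≠ a) :
    unary W (homog a s) m = 0 := by
  apply inclK_injective
  rw [← inclLin_apply, inclLin_unary, inclLin_homog, map_zero]
  cases a with
  | zero => rw [koszulGr_homog_zero]; rfl
  | succ a => rw [koszulGr_homog_succ, DirectSum.of_eq_of_ne _ _ _ (by omega)]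

theorem binary_degree (a b : ℕ) (s : Sec V (KFib W a)) (t : Sec V (KFib W b)) (m : ℕ)
    (h : m ≠ a + b) : binary W (homog a s) (homog b t) m = 0 := by
  apply inclK_injective
  rw [← inclLin_apply, inclLin_binary, inclLin_homog, inclLin_homog, map_zero, nrGr_eq_nrBracket]
  obtain ⟨u, hu, h'⟩ := exists_nrBracket_eq W (inclK_mem_secK W s) (inclK_mem_secK W t)
  rw [h', DirectSum.of_eq_of_ne _ _ _ h]

theorem binary_skew (a b : ℕ) (s : Sec V (KFib W a)) (t : Sec V (KFib W b)) :
    binary W (homog b t) (homog a s) = -(-1 : ℝ) ^ (a * b) • binary W (homog a s) (homog b t) := by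
  apply inclLin_injective
  rw [map_smul, inclLin_binary, inclLin_binary, inclLin_homog, inclLin_homog, nrGr_homog_skew]

theorem unary_unary (a : ℕ) (s : Sec V (KFib W a)) : unary W (unary W (homog a s)) = 0 := by
  apply inclLin_injective
  rw [inclLin_unary, inclLin_unary, inclLin_homog, koszulGr_koszulGr, map_zero]

theorem unary_binary (a b : ℕ) (s : Sec V (KFib W a)) (t : Sec V (KFib W b)) :
    unary W (binary W (homog a s) (homog b t)) = binary W (unary W (homog a s)) (homog b t) +
      (-1 : ℝ) ^ a • binary W (homog a s) (unary W (homog b t)) := by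
  apply inclLin_injective
  simp only [map_add, map_smul, inclLin_unary, inclLin_binary, inclLin_homog]
  exact koszulGr_nrGr a b _ _

theorem binary_unary_skew (a b : ℕ) (s : Sec V (KFib W a)) (t : Sec V (KFib W b)) :
    binary W (unary W (homog b t)) (homog a s) =
      -(-1 : ℝ) ^ (a * b + a) • binary W (homog a s) (unary W (homog b t)) := by
  cases b with
  | zero =>
    have h : unary W (homog 0 t) = 0 := by
      apply inclLin_injective
      rw [inclLin_unary, inclLin_homog, koszulGr_homog_zero, map_zero]
    rw [h, map_zero, map_zero, LinearMap.zero_apply, smul_zero]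
  | succ b =>
    have h : unary W (homog (b + 1) t) =
        homog b (mapSec (retr W b) (koszul (b + 1) (inclK W (b + 1) t))) := by
      rw [← retrLin_homog, ← koszulGr_homog_succ, ← inclLin_homog]
      rfl
    rw [h, binary_skew, show a * (b + 1) + a = a * b + (a + a) by ring, pow_add _ _ (a + a),
      (Even.add_self a).neg_one_pow, mul_one]

theorem binary_jacobi (a b c : ℕ) (s : Sec V (KFib W a)) (t : Sec V (KFib W b))
    (u : Sec V (KFib W c)) :
    binary W (binary W (homog a s) (homog b t)) (homog c u) -
      (-1 : ℝ) ^ (b * c) • binary W (binary W (homog a s) (homog c u)) (homog b t) +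
      (-1 : ℝ) ^ (a * b + a * c) • binary W (binary W (homog b t) (homog c u)) (homog a s) = 0 := by
  apply inclLin_injective
  simp only [map_add, map_sub, map_smul, inclLin_binary, inclLin_homog, map_zero]
  exact nrGr_jacobi a b c _ _ _

theorem unary_fun_smul (f : SmoothFun V) (g : GrSec V (KFib W)) :
    unary W (f • g) = f • unary W g := by
  apply inclLin_injective
  rw [inclLin_fun_smul, inclLin_unary, inclLin_unary, inclLin_fun_smul, koszulGr_fun_smul]

theorem binary_leibniz (x y : GrSec V (KFib W)) (f : SmoothFun V) :
    binary W x (f • y) = f • binary W x y + dirDeriv (anchorMap (inclK W 0 (x 0))) f • y := by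
  apply inclLin_injective
  rw [map_add, inclLin_fun_smul, inclLin_fun_smul, inclLin_binary, inclLin_binary, inclLin_fun_smul,
    nrGr_leibniz, inclLin_apply]

theorem brackets_jacobi (n : ℕ) (d : Fin n → ℕ) (x : ∀ p, Sec V (KFib W (d p))) :
    jacobiator (unary W) (binary W) d (homogTuple d x) = 0 := by
  by_cases hn : 4 ≤ n
  · exact jacobiator_of_four_le _ _ hn _ _
  obtain rfl | rfl | rfl | rfl : n = 0 ∨ n = 1 ∨ n = 2 ∨ n = 3 := by omega
  · refine Finset.sum_eq_zero fun S hS => ?_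
    obtain ⟨i, -⟩ := (Finset.mem_filter.1 hS).2
    exact i.elim0
  · exact jacobiator_one _ _ _ _ (unary_unary W (d 0) (x 0))
  -- The unshuffle sign times the sign of exchanging the two arguments is the Leibniz sign of the
  -- derivation rule.
  · have h : ((-1 : ℝ) ^ (d 1 * d 0)) * (-1) ^ (d 0 * d 1 + d 0) = (-1) ^ d 0 := by
      rw [← pow_add, show d 1 * d 0 + (d 0 * d 1 + d 0) = d 0 * d 1 + d 0 * d 1 + d 0 by ring,
        pow_add, (Even.add_self _).neg_one_pow, one_mul]
    rw [jacobiator_two, unary_binary, binary_unary_skew W (d 0) (d 1) (x 0) (x 1), smul_smul,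
      mul_neg, h]
    module
  · rw [jacobiator_three]
    exact binary_jacobi W (d 0) (d 1) (d 2) (x 0) (x 1) (x 2)

theorem skewSign_one {k : ℕ} (d : Fin k → ℕ) : skewSign d 1 = 1 :=
  Finset.prod_eq_one fun _ _ => Finset.prod_eq_one fun _ _ =>
    if_neg fun h => absurd h.1 (not_lt.2 h.2.le)

theorem brackets_skew (k : ℕ) (d : Fin k → ℕ) (x : ∀ p, Sec V (KFib W (d p)))
    (σ : Equiv.Perm (Fin k)) : brackets W k (homogTuple d x ∘ σ) =
      skewSign d σ • brackets W k (homogTuple d x) := by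
  by_cases h1 : k = 1
  · subst h1
    rw [Subsingleton.elim σ 1, skewSign_one, one_smul]
    rfl
  by_cases h2 : k = 2
  · subst h2
    have hσ : ∀ σ : Equiv.Perm (Fin 2), σ = 1 ∨ σ = Equiv.swap 0 1 := by decide
    rcases hσ σ with rfl | rfl
    · rw [skewSign_one, one_smul]
      rfl
    · have h : skewSign d (Equiv.swap 0 1) = -(-1) ^ (d 0 * d 1) := by
        simp [skewSign, Fin.prod_univ_two, mul_comm]
      rw [h]
      exact binary_skew W (d 0) (d 1) (x 0) (x 1)
  · rw [brackets_eq_zero W h1 h2]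
    simp

theorem brackets_degree (k : ℕ) (d : Fin k → ℕ) (x : ∀ p, Sec V (KFib W (d p))) (m : ℕ)
    (h : -(m : ℤ) ≠ (∑ p, -(d p : ℤ)) + (2 - k)) : brackets W k (homogTuple d x) m = 0 := by
  by_cases h1 : k = 1
  · subst h1
    refine unary_degree W (d 0) (x 0) m fun h' => h ?_
    simp
    omega
  by_cases h2 : k = 2
  · subst h2
    refine binary_degree W (d 0) (d 1) (x 0) (x 1) m fun h' => h ?_
    simp
    omega
  · rw [brackets_eq_zero W h1 h2]
    rfl

theorem brackets_smul (k : ℕ) (hk : k ≠ 2) (x : Fin k → GrSec V (KFib W)) (p : Fin k)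
    (f : SmoothFun V) : brackets W k (Function.update x p (f • x p)) = f • brackets W k x := by
  by_cases h1 : k = 1
  · subst h1
    obtain rfl := Subsingleton.elim p 0
    rw [brackets_one, brackets_one, Function.update_self, unary_fun_smul]
  · rw [brackets_eq_zero W h1 hk]
    exact (smul_zero f).symm

/-- The `L_∞`-algebroid structure on `K_•`. -/
def algebroid : LInftyAlgebroid V (KFib W) where
  bracket := brackets W
  anchor := anchorMap ∘ₗ inclK W 0
  degree := brackets_degree W
  skew := brackets_skew W
  jacobi := brackets_jacobi W
  bracket_smul := brackets_smul W
  leibniz := binary_leibniz W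
  anchor_bracket s t := by
    change anchorMap (inclK W 0 (binary W (homog 0 s) (homog 0 t) 0)) = _
    rw [← inclLin_apply, inclLin_binary, inclLin_homog, inclLin_homog]
    exact anchorMap_nrGr _ _
  anchor_diff s := by
    change anchorMap (inclK W 0 (unary W (homog 1 s) 0)) = 0
    rw [← inclLin_apply, inclLin_unary, inclLin_homog, koszulGr_homog_succ, DirectSum.of_eq_same,
      anchorMap_koszul]

theorem inclK_diff (i : ℕ) (s : Sec V (KFib W (i + 1))) :
    inclK W i ((algebroid W).diff i s) = koszul (i + 1) (inclK W (i + 1) s) := by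
  change inclK W i (unary W (homog (i + 1) s) i) = _
  rw [← inclLin_apply, inclLin_unary, inclLin_homog, koszulGr_homog_succ, DirectSum.of_eq_same]

theorem algebroid_isUniversal : (algebroid W).IsUniversal (foliation W) := by
  refine ⟨?_, fun s => ⟨fun h => ?_, ?_⟩, fun i s => ⟨fun h => ?_, ?_⟩⟩
  · rw [← map_anchorMap]
    ext X
    constructor
    · rintro ⟨s, rfl⟩
      exact ⟨_, inclK_mem_secK W s, rfl⟩
    · rintro ⟨s, hs, rfl⟩
      exact ⟨mapSec (retr W 0) s, congrArg anchorMap (inclK_retr W hs)⟩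
  · obtain ⟨η, hη, h'⟩ := exact_secK_zero W (inclK_mem_secK W s) h
    exact ⟨mapSec (retr W 1) η, inclK_injective W 0 (by rw [inclK_diff, inclK_retr W hη, h'])⟩
  · rintro ⟨t, rfl⟩
    exact (algebroid W).anchor_diff t
  · obtain ⟨η, hη, h'⟩ := exact_secK_succ W i (inclK_mem_secK W s)
      (by rw [← inclK_diff, h, map_zero])
    exact ⟨mapSec (retr W (i + 2)) η,
      inclK_injective W (i + 1) (by rw [inclK_diff, inclK_retr W hη, h'])⟩
  · rintro ⟨t, rfl⟩
    apply inclK_injective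
    rw [inclK_diff, inclK_diff, koszul_koszul, map_zero]

/-- The Euler field vanishes at the origin, hence so does contraction with it. -/
theorem algebroid_isMinimalAt : (algebroid W).IsMinimalAt 0 := by
  intro i s
  have h := congrArg (fun t => t 0) (inclK_diff W i s)
  have h0 : koszul (i + 1) (inclK W (i + 1) s) 0 = 0 := by
    ext v
    exact (inclK W (i + 1) s 0).map_coord_zero 0 rfl
  simp only [h0] at h
  rw [← retr_inclFib W ((algebroid W).diff i s 0)]
  exact (congrArg (retr W i) h).trans (map_zero _)

theorem inclGr_bracket_one (j : ℕ) (s : Sec V (KFib W (j + 1))) :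
    inclGr W ((algebroid W).bracket 1 ![homog (F := KFib W) (j + 1) s]) =
      homog (F := AltFib V) j (koszul (j + 1) (inclK W (j + 1) s)) := by
  change inclLin W (unary W (homog (j + 1) s)) = _
  rw [inclLin_unary, inclLin_homog, koszulGr_homog_succ]

theorem inclGr_bracket_two (a b : ℕ) (s : Sec V (KFib W a)) (t : Sec V (KFib W b)) :
    inclGr W ((algebroid W).bracket 2 ![homog (F := KFib W) a s, homog (F := KFib W) b t]) =
      nrBracket (inclK W a s) (inclK W b t) := by
  change inclLin W (binary W (homog a s) (homog b t)) = _
  rw [inclLin_binary, inclLin_homog, inclLin_homog, nrGr_eq_nrBracket]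

theorem algebroid_isDGLie : (algebroid W).IsDGLie := fun _ _ =>
  brackets_eq_zero W (by omega) (by omega)

theorem secK_inf_ker_koszul (j : ℕ) : secK W (j + 1) ⊓ LinearMap.ker (koszul (j + 1)) =
    (secK W (j + 2)).map (koszul (j + 2)) := by
  refine le_antisymm (fun s hs => exact_secK_succ W j hs.1 hs.2) ?_
  rintro _ ⟨η, hη, rfl⟩
  exact ⟨koszul_mem_secK W hη, koszul_koszul _ η⟩

theorem secK_inf_ker_anchorMap :
    secK W 0 ⊓ LinearMap.ker anchorMap = (secK W 1).map (koszul 1) := by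
  refine le_antisymm (fun s hs => exact_secK_zero W hs.1 hs.2) ?_
  rintro _ ⟨η, hη, rfl⟩
  exact ⟨koszul_mem_secK W hη, anchorMap_koszul η⟩

end Algebroid

end SubspaceFoliation

end

theorem mainTheorem1 {V : Type*} [NormedAddCommGroup V] [NormedSpace ℝ V] [FiniteDimensional ℝ V]
    (W : Submodule ℝ V) :
    -- `𝓕_W` is involutive and finitely generated
    ((∀ X ∈ foliation W, ∀ Y ∈ foliation W, lieBr X Y ∈ foliation W) ∧ (foliation W).FG) ∧
    -- the differentials restrict
    (∀ (j : ℕ), ∀ s ∈ secK W (j + 1), koszul (j + 1) s ∈ secK W j) ∧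
    -- the bracket restricts
    (∀ (a b : ℕ), ∀ s ∈ secK W a, ∀ t ∈ secK W b, ∃ u ∈ secK W (a + b),
      nrBracket s t = homog (F := AltFib V) (a + b) u) ∧
    -- the sequence `0 → Γ(K_n) → … → Γ(K_1) → 𝓕_W → 0` is exact, where `n = dim V`
    ((∀ j, Module.finrank ℝ V ≤ j → K W j = ⊥) ∧
      (∀ j, (secK W (j + 1) ⊓ LinearMap.ker (koszul (j + 1)) =
        (secK W (j + 2)).map (koszul (j + 2)))) ∧
      secK W 0 ⊓ LinearMap.ker anchorMap = (secK W 1).map (koszul 1) ∧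
      (secK W 0).map anchorMap = foliation W) ∧
    -- `Γ(K_•)` with the restricted operations is a minimal universal `L_∞`-algebroid of `𝓕_W`
    ∃ L : LInftyAlgebroid V (KFib W),
      (∀ s : Sec V (KFib W 0), L.anchor s = anchorMap (inclK W 0 s)) ∧
      (∀ (j : ℕ) (s : Sec V (KFib W (j + 1))),
        inclGr W (L.bracket 1 ![homog (F := KFib W) (j + 1) s]) =
          homog (F := AltFib V) j (koszul (j + 1) (inclK W (j + 1) s))) ∧
      (∀ (a b : ℕ) (s : Sec V (KFib W a)) (t : Sec V (KFib W b)),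
        inclGr W (L.bracket 2 ![homog (F := KFib W) a s, homog (F := KFib W) b t]) =
          nrBracket (inclK W a s) (inclK W b t)) ∧
      L.IsDGLie ∧
      L.IsUniversal (foliation W) ∧
      L.IsMinimalAt 0 := by
  refine ⟨⟨fun X hX Y hY => lieBr_mem_foliation hX hY, foliation_fg W⟩,
    fun j s hs => koszul_mem_secK W hs, fun a b s hs t ht => exists_nrBracket_eq W hs ht,
    ⟨fun j hj => K_eq_bot W hj, secK_inf_ker_koszul W, secK_inf_ker_anchorMap W, map_anchorMap W⟩,
    algebroid W, ?_, inclGr_bracket_one W, inclGr_bracket_two W, algebroid_isDGLie W,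
    algebroid_isUniversal W, algebroid_isMinimalAt W⟩
  intro s
  rfl
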